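/- Let $E_0,E_1$ be Banach spaces with $E_1$ densely and continuously embedded in $E_0$. For $\theta\in(0,1)$ let $E_\theta=(E_0,E_1)^0_{\theta,\infty}$ be the continuous interpolation space: with $K(t,x)=\inf\{|a|_{E_0}+t|b|_{E_1}: x=a+b\}$, it is the space of those $x\in E_0$ for which $\sup_{t>0}t^{-\theta}K(t,x)<\infty$ and $t^{-\theta}K(t,x)\to0$ as $t\to0^+$, with norm $|x|_{E_\theta}=\sup_{t>0}t^{-\theta}K(t,x)$. Fix $\mu\in(0,1)$. For $J=[0,T]$, $\dot J=(0,T]$ and a Banach space $E$, let $BC_{1-\mu}(J,E)$ be the set of $v\in C(\dot J,E)$ such that $t^{1-\mu}v(t)$ is bounded on $\dot J$ and $t^{1-\mu}|v(t)|_E\to0$ as $t\to0^+$, let $BC^1_{1-\mu}(J,E)=\{v\in C^1(\dot J,E): v,\dot v\in BC_{1-\mu}(J,E)\}$, and set $$\mathbb E_{0,\mu}(J)=BC_{1-\mu}(J,E_0),\qquad \mathbb E_{1,\mu}(J)=BC^1_{1-\mu}(J,E_0)\cap BC_{1-\mu}(J,E_1),$$ $$\|v\|_{\mathbb E_{1,\mu}(J)}=\sup_{t\in\dot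 J}t^{1-\mu}\big(|\dot v(t)|_{E_0}+|v(t)|_{E_1}\big).$$ For $v\in\mathbb E_{1,\mu}(J)$, $v(0)$ denotes the limit of $v(t)$ in $E_0$ as $t\to0^+$. Let $\mathcal M_\mu(E_1,E_0)$ be the set of $B\in\mathcal L(E_1,E_0)$ such that for some $T>0$, for every $(f,x)\in\mathbb E_{0,\mu}([0,T])\times E_\mu$, there is a unique $u\in\mathbb E_{1,\mu}([0,T])$ with $\dot u+Bu=f$ on $(0,T]$ and $u(0)=x$. Let $V_\mu\subset E_\mu$ be open, and assume: **(H1)** $(A,F_1):V_\mu\to\mathcal L(E_1,E_0)\times E_0$ is locally Lipschitz continuous and $A(x)\in\mathcal M_\mu(E_1,E_0)$ for all $x\in V_\mu$. **(H2)** There is $\beta\in(\mu,1)$ such that $F_2:V_\mu\cap E_\beta\to E_0$, and there are $m\in\mathbb N$ and numbers $\beta_j\in[\mu,\beta]$, $\rho_j\ge0$ with $$\frac{\rho_j(\beta-\mu)+(\beta_j-\mu)}{1-\mu}\le1\qquad(j=1,\dots,m),$$ such that for each $x_0\in V_\mu$ and $R>0$ there is a constant $C_R=C_R(x_0)>0$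 with $$|F_2(x_1)-F_2(x_2)|_{E_0}\le C_R\sum_{j=1}^m\big(1+|x_1|_{E_\beta}^{\rho_j}+|x_2|_{E_\beta}^{\rho_j}\big)|x_1-x_2|_{E_{\beta_j}}$$ for all $x_1,x_2\in\bar B_{E_\mu}(x_0,R)\cap V_\mu\cap E_\beta$. Consider the problem $$\dot u+A(u)u=F_1(u)+F_2(u)\quad(t>0),\qquad u(0)=x. \qquad (*)$$ A solution on $[0,T]$ is a function $u\in\mathbb E_{1,\mu}([0,T])$ with values in $V_\mu$ that satisfies the equation on $(0,T]$ and $u(0)=x\in V_\mu$. Then: **(a) Local solutions.** For every $x_0\in V_\mu$ there are $\tau,\varepsilon,\sigma>0$ such that for every $x\in\bar B_{E_\mu}(x_0,\varepsilon)$ problem $(*)$ has a unique solution $u(\cdot,x)\in\mathbb E_{1,\mu}([0,\tau])$, and $$\|u(\cdot,x_1)-u(\cdot,x_2)\|_{\mathbb E_{1,\mu}([0,\tau])}\le\sigma|x_1-x_2|_{E_\mu}\qquad\text{for all }x_1,x_2\in\bar B_{E_\mu}(x_0,\varepsilon).$$ **(b) Maximal solutions.** For every $x_0\in V_\mu$ there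 are $t^+=t^+(x_0)\in(0,\infty]$ and a function $u(\cdot,x_0)$ on $J(x_0):=[0,t^+)$ that is a solution with initial value $x_0$ on $[0,T]$ for every $T\in(0,t^+)$, and such that every solution with initial value $x_0$ on an interval $[0,T]$, $T>0$, satisfies $T<t^+$ and is the restriction of $u(\cdot,x_0)$. Moreover, $$u(\cdot,x_0)\in C([0,t^+),E_\mu)\cap C((0,t^+),E_1).$$ **(c) Global solutions.** Let $x_0\in V_\mu$. If (i) $u(\cdot,x_0):J(x_0)\to E_\mu$ is uniformly continuous, and (ii) there is $\eta>0$ with $\operatorname{dist}_{E_\mu}(u(t,x_0),\partial V_\mu)>\eta$ for all $t\in J(x_0)$ (where the distance to the empty set is $\infty$), then $t^+(x_0)=\infty$, that is, $u(\cdot,x_0)$ is a global solution of $(*)$. If the embedding $E_1\hookrightarrow E_0$ is compact, then condition (i) may be replaced by (i.a) for some $\delta\in(\mu,1]$ and some $\tau\in(0,t^+(x_0))$ the orbit $\{u(t,x_0):t\in[\tau,t^+(x_0))\}$ is bounded in $E_\delta$. -/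

import Mathlib

open Set Filter Topology

noncomputable section

namespace QuasiPar

section Interp

variable {E₀ E₁ : Type*} [NormedAddCommGroup E₀] [NormedSpace ℝ E₀]
  [NormedAddCommGroup E₁] [NormedSpace ℝ E₁]

/-- Peetre's `K`-functional of the pair `(E₀, E₁)`, where `E₁` is embedded in `E₀` by `ι`:
the infimum of `‖a‖ + t ‖y‖` over all decompositions `x = a + ι y`. -/
def kFun (ι : E₁ →L[ℝ] E₀) (t : ℝ) (x : E₀) : ℝ :=
  ⨅ y : E₁, (‖x - ι y‖ + t * ‖y‖)

/-- The norm `sup_{t > 0} t ^ (-θ) K(t, x)` of the real interpolation space `(E₀, E₁)_{θ,∞}`. -/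
def interpNorm (ι : E₁ →L[ℝ] E₀) (θ : ℝ) (x : E₀) : ℝ :=
  ⨆ t : Ioi (0 : ℝ), (t : ℝ) ^ (-θ) * kFun ι t x

theorem kFun_bdd (ι : E₁ →L[ℝ] E₀) {t : ℝ} (ht : 0 < t) (x : E₀) :
    BddBelow (range fun y : E₁ => ‖x - ι y‖ + t * ‖y‖) :=
  ⟨0, by rintro _ ⟨y, rfl⟩; positivity⟩

theorem kFun_nonneg (ι : E₁ →L[ℝ] E₀) {t : ℝ} (ht : 0 < t) (x : E₀) : 0 ≤ kFun ι t x :=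
  Real.iInf_nonneg fun y => by positivity

theorem kFun_le (ι : E₁ →L[ℝ] E₀) {t : ℝ} (ht : 0 < t) (x : E₀) (y : E₁) :
    kFun ι t x ≤ ‖x - ι y‖ + t * ‖y‖ :=
  ciInf_le (kFun_bdd ι ht x) y

theorem kFun_add (ι : E₁ →L[ℝ] E₀) {t : ℝ} (ht : 0 < t) (x x' : E₀) :
    kFun ι t (x + x') ≤ kFun ι t x + kFun ι t x' := by
  refine le_ciInf_add_ciInf fun y y' => ?_
  refine (kFun_le ι ht _ (y + y')).trans ?_
  have h1 : ‖x + x' - ι (y + y')‖ ≤ ‖x - ι y‖ + ‖x' - ι y'‖ := by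
    rw [map_add, add_sub_add_comm]; exact norm_add_le _ _
  have h2 := mul_le_mul_of_nonneg_left (norm_add_le y y') ht.le
  linarith

theorem kFun_smul (ι : E₁ →L[ℝ] E₀) {t : ℝ} (ht : 0 < t) (c : ℝ) (x : E₀) :
    kFun ι t (c • x) ≤ ‖c‖ * kFun ι t x := by
  unfold kFun
  rw [Real.mul_iInf_of_nonneg (norm_nonneg c)]
  refine le_ciInf fun y => ?_
  refine (kFun_le ι ht _ (c • y)).trans (le_of_eq ?_)
  rw [map_smul, ← smul_sub, norm_smul, norm_smul]; ring

theorem kFun_zero (ι : E₁ →L[ℝ] E₀) {t : ℝ} (ht : 0 < t) : kFun ι t 0 = 0 :=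
  le_antisymm (by simpa using kFun_le ι ht 0 0) (kFun_nonneg ι ht 0)

theorem norm_le_kFun (ι : E₁ →L[ℝ] E₀) (x : E₀) :
    ‖x‖ ≤ (1 + ‖ι‖) * kFun ι 1 x := by
  unfold kFun
  rw [Real.mul_iInf_of_nonneg (by positivity)]
  refine le_ciInf fun y => ?_
  have h1 : ‖x‖ ≤ ‖x - ι y‖ + ‖ι y‖ := by simpa using norm_add_le (x - ι y) (ι y)
  have h2 := ι.le_opNorm y
  nlinarith [norm_nonneg y, norm_nonneg ι, norm_nonneg (x - ι y),
    mul_nonneg (norm_nonneg ι) (norm_nonneg (x - ι y))]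

/-- The continuous interpolation space `(E₀, E₁)⁰_{θ,∞}` as a linear subspace of `E₀`: the
elements `x` of `(E₀, E₁)_{θ,∞}` for which `t ^ (-θ) K(t, x) → 0` as `t → 0+`.
For `0 < θ < 1` this is the closure of `E₁` in `(E₀, E₁)_{θ,∞}`. -/
def interpSubmodule (ι : E₁ →L[ℝ] E₀) (θ : ℝ) : Submodule ℝ E₀ where
  carrier := {x | BddAbove (range fun t : Ioi (0 : ℝ) => (t : ℝ) ^ (-θ) * kFun ι t x) ∧
    Tendsto (fun t : ℝ => t ^ (-θ) * kFun ι t x) (𝓝[>] 0) (𝓝 0)}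
  zero_mem' := by
    refine ⟨⟨0, ?_⟩, ?_⟩
    · rintro _ ⟨t, rfl⟩
      simp [kFun_zero ι t.2]
    · refine tendsto_const_nhds.congr' ?_
      filter_upwards [self_mem_nhdsWithin] with t ht
      simp [kFun_zero ι ht]
  add_mem' := by
    rintro x y ⟨⟨C, hC⟩, hx⟩ ⟨⟨D, hD⟩, hy⟩
    have key : ∀ t : ℝ, 0 < t → t ^ (-θ) * kFun ι t (x + y) ≤
        t ^ (-θ) * kFun ι t x + t ^ (-θ) * kFun ι t y := fun t ht => by
      rw [← mul_add]
      exact mul_le_mul_of_nonneg_left (kFun_add ι ht x y) (Real.rpow_nonneg ht.le _)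
    refine ⟨⟨C + D, ?_⟩, ?_⟩
    · rintro _ ⟨t, rfl⟩
      exact (key t t.2).trans (add_le_add (hC ⟨t, rfl⟩) (hD ⟨t, rfl⟩))
    · have h := hx.add hy
      rw [add_zero] at h
      refine tendsto_of_tendsto_of_tendsto_of_le_of_le' tendsto_const_nhds h ?_ ?_
      · filter_upwards [self_mem_nhdsWithin] with t ht
        exact mul_nonneg (Real.rpow_nonneg (le_of_lt ht) _) (kFun_nonneg ι ht _)
      · filter_upwards [self_mem_nhdsWithin] with t ht using key t ht
  smul_mem' := by
    rintro c x ⟨⟨C, hC⟩, hx⟩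
    have key : ∀ t : ℝ, 0 < t → t ^ (-θ) * kFun ι t (c • x) ≤
        ‖c‖ * (t ^ (-θ) * kFun ι t x) := fun t ht => by
      rw [mul_left_comm]
      exact mul_le_mul_of_nonneg_left (kFun_smul ι ht c x) (Real.rpow_nonneg ht.le _)
    refine ⟨⟨‖c‖ * C, ?_⟩, ?_⟩
    · rintro _ ⟨t, rfl⟩
      exact (key t t.2).trans (mul_le_mul_of_nonneg_left (hC ⟨t, rfl⟩) (norm_nonneg c))
    · have h := hx.const_mul ‖c‖
      rw [mul_zero] at h
      refine tendsto_of_tendsto_of_tendsto_of_le_of_le' tendsto_const_nhds h ?_ ?_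
      · filter_upwards [self_mem_nhdsWithin] with t ht
        exact mul_nonneg (Real.rpow_nonneg (le_of_lt ht) _) (kFun_nonneg ι ht _)
      · filter_upwards [self_mem_nhdsWithin] with t ht using key t ht

/-- The continuous interpolation space `E_θ = (E₀, E₁)⁰_{θ,∞}` as a type; it carries the norm of
`(E₀, E₁)_{θ,∞}` (below), not the norm of `E₀`. -/
def Interp (ι : E₁ →L[ℝ] E₀) (θ : ℝ) : Type _ := interpSubmodule ι θ

variable (ι : E₁ →L[ℝ] E₀) (θ : ℝ)

instance : AddCommGroup (Interp ι θ) := inferInstanceAs (AddCommGroup (interpSubmodule ι θ))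

instance : Module ℝ (Interp ι θ) := inferInstanceAs (Module ℝ (interpSubmodule ι θ))

variable {ι θ}

/-- The inclusion of `E_θ` in `E₀`. -/
def Interp.val (x : Interp ι θ) : E₀ := Subtype.val x

theorem Interp.bdd (x : Interp ι θ) :
    BddAbove (range fun t : Ioi (0 : ℝ) => (t : ℝ) ^ (-θ) * kFun ι t x.val) := x.2.1

theorem Interp.ext {x y : Interp ι θ} (h : x.val = y.val) : x = y := Subtype.ext h

variable (ι θ)

instance : Norm (Interp ι θ) := ⟨fun x => interpNorm ι θ x.val⟩

theorem Interp.core : NormedSpace.Core ℝ (Interp ι θ) where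
  norm_nonneg x := Real.iSup_nonneg fun t =>
    mul_nonneg (Real.rpow_nonneg (le_of_lt t.2) _) (kFun_nonneg ι t.2 _)
  norm_smul c x := by
    have hle : ∀ (c : ℝ) (x : Interp ι θ), ‖c • x‖ ≤ ‖c‖ * ‖x‖ := fun c x => by
      refine ciSup_le fun t => ?_
      have h1 := kFun_smul ι t.2 c x.val
      have h2 : (t : ℝ) ^ (-θ) * kFun ι t x.val ≤ ‖x‖ := le_ciSup x.bdd t
      calc (t : ℝ) ^ (-θ) * kFun ι t (c • x).val
          ≤ (t : ℝ) ^ (-θ) * (‖c‖ * kFun ι t x.val) :=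
            mul_le_mul_of_nonneg_left h1 (Real.rpow_nonneg (le_of_lt t.2) _)
        _ = ‖c‖ * ((t : ℝ) ^ (-θ) * kFun ι t x.val) := by ring
        _ ≤ ‖c‖ * ‖x‖ := mul_le_mul_of_nonneg_left h2 (norm_nonneg c)
    refine le_antisymm (hle c x) ?_
    by_cases hc : c = 0
    · subst hc
      rw [norm_zero, zero_mul]
      exact Real.iSup_nonneg fun t : Ioi (0 : ℝ) =>
        mul_nonneg (Real.rpow_nonneg (le_of_lt t.2) _) (kFun_nonneg ι t.2 _)
    · have h := hle c⁻¹ (c • x)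
      rw [inv_smul_smul₀ hc, norm_inv] at h
      have hc' : 0 < ‖c‖ := norm_pos_iff.2 hc
      calc ‖c‖ * ‖x‖ ≤ ‖c‖ * (‖c‖⁻¹ * ‖c • x‖) := mul_le_mul_of_nonneg_left h hc'.le
        _ = ‖c • x‖ := by field_simp
  norm_triangle x y := by
    refine ciSup_le fun t => ?_
    have h1 := kFun_add ι t.2 x.val y.val
    have h2 : (t : ℝ) ^ (-θ) * kFun ι t x.val ≤ ‖x‖ := le_ciSup x.bdd t
    have h3 : (t : ℝ) ^ (-θ) * kFun ι t y.val ≤ ‖y‖ := le_ciSup y.bdd t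
    have h4 := mul_le_mul_of_nonneg_left h1 (Real.rpow_nonneg (le_of_lt t.2) (-θ))
    rw [mul_add] at h4
    exact h4.trans (add_le_add h2 h3)
  norm_eq_zero_iff x := by
    constructor
    · intro h
      have h2 : ((1 : ℝ)) ^ (-θ) * kFun ι 1 x.val ≤ ‖x‖ :=
        le_ciSup x.bdd ⟨(1 : ℝ), mem_Ioi.2 one_pos⟩
      rw [h, Real.one_rpow, one_mul] at h2
      have h3 := norm_le_kFun ι x.val
      have h4 : kFun ι 1 x.val = 0 := le_antisymm h2 (kFun_nonneg ι one_pos _)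
      rw [h4, mul_zero] at h3
      exact Interp.ext (norm_le_zero_iff.1 h3)
    · rintro rfl
      refine le_antisymm (ciSup_le fun t => ?_) (Real.iSup_nonneg fun t =>
        mul_nonneg (Real.rpow_nonneg (le_of_lt t.2) _) (kFun_nonneg ι t.2 _))
      have : kFun ι t (0 : Interp ι θ).val = 0 := kFun_zero ι t.2
      rw [this, mul_zero]

instance : NormedAddCommGroup (Interp ι θ) := NormedAddCommGroup.ofCore (Interp.core ι θ)

instance : NormedSpace ℝ (Interp ι θ) := NormedSpace.ofCore (Interp.core ι θ)

variable {θ}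

theorem mem_interp (hθ : θ ∈ Ioo (0 : ℝ) 1) (y : E₁) : ι y ∈ interpSubmodule ι θ := by
  have h1 : ∀ t : ℝ, 0 < t → t ^ (-θ) * kFun ι t (ι y) ≤ t ^ (1 - θ) * ‖y‖ := fun t ht => by
    have h := kFun_le ι ht (ι y) y
    rw [sub_self, norm_zero, zero_add] at h
    calc t ^ (-θ) * kFun ι t (ι y) ≤ t ^ (-θ) * (t * ‖y‖) :=
          mul_le_mul_of_nonneg_left h (Real.rpow_nonneg ht.le _)
      _ = t ^ (1 - θ) * ‖y‖ := by
          rw [← mul_assoc, ← Real.rpow_add_one ht.ne', neg_add_eq_sub]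
  refine ⟨⟨‖y‖ + ‖ι y‖, ?_⟩, ?_⟩
  · rintro _ ⟨⟨t, ht⟩, rfl⟩
    have ht' : 0 < t := ht
    rcases le_total t 1 with h | h
    · have h2 : t ^ (1 - θ) ≤ 1 := Real.rpow_le_one ht'.le h (by linarith [hθ.2])
      have h3 := h1 t ht'
      have h4 := mul_le_mul_of_nonneg_right h2 (norm_nonneg y)
      have h5 := norm_nonneg (ι y)
      dsimp only
      linarith
    · have h2 : t ^ (-θ) ≤ 1 := Real.rpow_le_one_of_one_le_of_nonpos h (by linarith [hθ.1])
      have h3 := kFun_le ι ht' (ι y) 0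
      simp only [map_zero, sub_zero, norm_zero, mul_zero, add_zero] at h3
      have h4 := mul_le_mul h2 h3 (kFun_nonneg ι ht' _) zero_le_one
      have h5 := norm_nonneg y
      dsimp only
      linarith
  · have h : Tendsto (fun t : ℝ => t ^ (1 - θ) * ‖y‖) (𝓝[>] 0) (𝓝 0) := by
      have h0 : ContinuousAt (fun t : ℝ => t ^ (1 - θ)) 0 :=
        Real.continuousAt_rpow_const 0 _ (Or.inr (by linarith [hθ.2]))
      have h2 : Tendsto (fun t : ℝ => t ^ (1 - θ)) (𝓝[>] 0) (𝓝 0) := by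
        have := h0.tendsto.mono_left (nhdsWithin_le_nhds (s := Ioi (0 : ℝ)))
        rwa [Real.zero_rpow (by linarith [hθ.2])] at this
      simpa using h2.mul_const ‖y‖
    refine tendsto_of_tendsto_of_tendsto_of_le_of_le' tendsto_const_nhds h ?_ ?_
    · filter_upwards [self_mem_nhdsWithin] with t ht
      exact mul_nonneg (Real.rpow_nonneg (le_of_lt ht) _) (kFun_nonneg ι ht _)
    · filter_upwards [self_mem_nhdsWithin] with t ht using h1 t ht

/-- The embedding of `E₁` in `E_θ`, `0 < θ < 1`. -/
def Interp.of (hθ : θ ∈ Ioo (0 : ℝ) 1) (y : E₁) : Interp ι θ := ⟨ι y, mem_interp ι hθ y⟩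

/-- The norm of `y ∈ E₁` in `E_δ`, `0 < δ ≤ 1`: for `δ < 1` that of the interpolation space, and
for `δ = 1` that of the given space `E₁`. -/
def scaleNorm (δ : ℝ) (y : E₁) : ℝ :=
  if δ = 1 then ‖y‖ else interpNorm ι δ (ι y)

end Interp

section Weighted

/-- `v ∈ BC_{1-μ}([0,T], E)`: `v` is continuous on `(0,T]`, `t ^ (1-μ) v(t)` is bounded there
and tends to `0` as `t → 0+`. Only the values of `v` on `(0,T]` matter. -/
def MemBC {E : Type*} [NormedAddCommGroup E] (μ T : ℝ) (v : ℝ → E) : Prop :=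
  ContinuousOn v (Ioc 0 T) ∧
  (∃ C : ℝ, ∀ t ∈ Ioc 0 T, t ^ (1 - μ) * ‖v t‖ ≤ C) ∧
  Tendsto (fun t : ℝ => t ^ (1 - μ) * ‖v t‖) (𝓝[>] 0) (𝓝 0)

/-- `v ∈ BC¹_{1-μ}([0,T], E)`: `v ∈ C¹((0,T], E)` and `v`, `v'` belong to `BC_{1-μ}([0,T], E)`;
the derivative at `T` is one-sided. -/
def MemBC1 {E : Type*} [NormedAddCommGroup E] [NormedSpace ℝ E] (μ T : ℝ) (v : ℝ → E) : Prop :=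
  DifferentiableOn ℝ v (Ioc 0 T) ∧ MemBC μ T v ∧ MemBC μ T (derivWithin v (Ioc 0 T))

variable {E₀ E₁ : Type*} [NormedAddCommGroup E₀] [NormedSpace ℝ E₀]
  [NormedAddCommGroup E₁] [NormedSpace ℝ E₁] (ι : E₁ →L[ℝ] E₀)

/-- The time derivative, in `E₀`, of a function `u : (0,T] → E₁`. -/
def dt (T : ℝ) (u : ℝ → E₁) (t : ℝ) : E₀ :=
  derivWithin (fun s => ι (u s)) (Ioc 0 T) t

/-- `u ∈ 𝔼_{1,μ}([0,T]) = BC¹_{1-μ}([0,T], E₀) ∩ BC_{1-μ}([0,T], E₁)`. -/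
def MemE1 (μ T : ℝ) (u : ℝ → E₁) : Prop :=
  MemBC1 μ T (fun t => ι (u t)) ∧ MemBC μ T u

/-- The norm of `𝔼_{1,μ}([0,T])`. -/
def normE1 (μ T : ℝ) (u : ℝ → E₁) : ℝ :=
  ⨆ t : Ioc 0 T, (t : ℝ) ^ (1 - μ) * (‖dt ι T u t‖ + ‖u t‖)

/-- `u(0) = x` in the sense of the trace operator: `u(t) → x` in `E₀` as `t → 0+`. -/
def HasTrace (u : ℝ → E₁) (x : E₀) : Prop :=
  Tendsto (fun t => ι (u t)) (𝓝[>] 0) (𝓝 x)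

/-- The set `𝓜_μ(E₁, E₀)` of the operators with continuous maximal regularity: for some `T > 0`
and every `(f, x) ∈ 𝔼_{0,μ}([0,T]) × E_μ` the linear problem `u' + B u = f` on `(0,T]`,
`u(0) = x`, has exactly one solution in `𝔼_{1,μ}([0,T])`. -/
def maxReg (μ : ℝ) : Set (E₁ →L[ℝ] E₀) :=
  {B | ∃ T : ℝ, 0 < T ∧ ∀ f : ℝ → E₀, MemBC μ T f → ∀ x : Interp ι μ,
    let Solves : (ℝ → E₁) → Prop := fun u =>
      MemE1 ι μ T u ∧ (∀ t ∈ Ioc 0 T, dt ι T u t + B (u t) = f t) ∧ HasTrace ι u x.val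
    ∃ u, Solves u ∧ ∀ v, Solves v → EqOn v u (Ioc 0 T)}

end Weighted

section Equation

variable {E₀ E₁ : Type*} [NormedAddCommGroup E₀] [NormedSpace ℝ E₀]
  [NormedAddCommGroup E₁] [NormedSpace ℝ E₁] (ι : E₁ →L[ℝ] E₀) {μ : ℝ}

/-- Condition (H1): `(A, F₁) ∈ C^{1-}(V, 𝓜_μ(E₁, E₀) × E₀)`. -/
def H1 (V : Set (Interp ι μ)) (A : Interp ι μ → E₁ →L[ℝ] E₀) (F₁ : Interp ι μ → E₀) : Prop :=
  LocallyLipschitzOn V (fun x => (A x, F₁ x)) ∧ ∀ x ∈ V, A x ∈ maxReg ι μ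

/-- Condition (H2). The nonlinearity `F₂` is only evaluated on `V ∩ E_β`; its values elsewhere
are irrelevant. -/
def H2 (V : Set (Interp ι μ)) (F₂ : Interp ι μ → E₀) : Prop :=
  ∃ β ∈ Ioo μ 1, ∃ (m : ℕ) (b ρ : Fin m → ℝ),
    (∀ j, b j ∈ Icc μ β ∧ 0 ≤ ρ j ∧ (ρ j * (β - μ) + (b j - μ)) / (1 - μ) ≤ 1) ∧
    ∀ x₀ ∈ V, ∀ R > 0, ∃ C > 0, ∀ x₁ ∈ Metric.closedBall x₀ R ∩ V,
      ∀ x₂ ∈ Metric.closedBall x₀ R ∩ V,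
      x₁.val ∈ interpSubmodule ι β → x₂.val ∈ interpSubmodule ι β →
        ‖F₂ x₁ - F₂ x₂‖ ≤ C * ∑ j,
          (1 + interpNorm ι β x₁.val ^ ρ j + interpNorm ι β x₂.val ^ ρ j) *
            interpNorm ι (b j) (x₁.val - x₂.val)

variable (hμ : μ ∈ Ioo (0 : ℝ) 1) (V : Set (Interp ι μ)) (A : Interp ι μ → E₁ →L[ℝ] E₀)
  (F₁ F₂ : Interp ι μ → E₀)

/-- `u ∈ 𝔼_{1,μ}([0,T])` is a (`V`-valued) solution of `u' + A(u) u = F₁(u) + F₂(u)` on `(0,T]`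
with `u(0) = x`. -/
def IsSolution (x : Interp ι μ) (T : ℝ) (u : ℝ → E₁) : Prop :=
  MemE1 ι μ T u ∧ x ∈ V ∧ HasTrace ι u x.val ∧
  ∀ t ∈ Ioc 0 T, Interp.of ι hμ (u t) ∈ V ∧
    dt ι T u t + A (Interp.of ι hμ (u t)) (u t) =
      F₁ (Interp.of ι hμ (u t)) + F₂ (Interp.of ι hμ (u t))

/-- `u` is the maximal solution with initial value `x`, on the right-open interval `[0, tp)`,
`0 < tp ≤ ∞`: it is a solution on `[0,T]` for all `0 < T < tp`, and every solution on an interval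
`[0,T]` is a restriction of `u`, with `T < tp`. -/
def IsMaximalSolution (x : Interp ι μ) (tp : EReal) (u : ℝ → E₁) : Prop :=
  0 < tp ∧
  (∀ T : ℝ, 0 < T → (T : EReal) < tp → IsSolution ι hμ V A F₁ F₂ x T u) ∧
  ∀ (T : ℝ) (v : ℝ → E₁), 0 < T → IsSolution ι hμ V A F₁ F₂ x T v →
    (T : EReal) < tp ∧ EqOn v u (Ioc 0 T)

/-- The orbit `t ↦ u(t) ∈ E_μ` of a solution `u` with initial value `x`, including `u(0) = x`. -/
def orbit (x : Interp ι μ) (u : ℝ → E₁) (t : ℝ) : Interp ι μ :=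
  if 0 < t then Interp.of ι hμ (u t) else x

/-- The distance of the orbit to the boundary of `V` in `E_μ` is bounded below by some `η > 0`
(the distance to the empty set being infinite). -/
def AwayFromBoundary (x : Interp ι μ) (tp : EReal) (u : ℝ → E₁) : Prop :=
  ∃ η : ℝ, 0 < η ∧ ∀ t : ℝ, 0 ≤ t → (t : EReal) < tp →
    ENNReal.ofReal η < Metric.infEDist (orbit ι hμ x u t) (frontier V)

end Equation

end QuasiPar

end

/-! The equation is written as the autonomous problem `u' = N(u)`, with `N` equal to `rhs`, and
solved by a contraction argument based on maximal regularity. Near `X ∈ V` let `B = A(X)`. The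
equation becomes `u' + B u = g` with `g = N(u) + B u`, and the solution of this linear problem is a
bounded linear function of `(g, x)`, by the closed graph theorem (`nonempty_solOp`). It remains to
see that `u ↦ N(u) + B u` has a small Lipschitz constant in the weighted norms as long as `u(t)`
stays near `X` in `E_μ` and `t ^ (1-μ) ‖u(t)‖` is small. This is the property `Admissible`.

For `A` and `F₁` it follows from local Lipschitz continuity. For `F₂` the norms in `E_β` and
`E_{β_j}` are interpolated between `E_μ` and `E₁`; the condition on the exponents in (H2) says that
the weight `t ^ (1-μ)` absorbs all the powers of `‖u(t)‖` in `E₁` that arise, and `β < 1` leaves a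
positive power of the small parameter (`weighted_growth_le`, `admissible_rhs`). The critical case of
equality is allowed, because smallness also comes from `t ^ (1-μ) ‖u(t)‖ → 0`.

The trace estimate `IntEq.norm_of_sub_le` bounds the oscillation of a solution in `E_μ` by its
weighted norms. It gives continuity in `E_μ` at time `0` and control of the linear solutions in
`E_μ`. The contraction (`Admissible.exists_sol`) then yields solutions on a common time interval for
all initial values in a ball, which proves (a). The same estimate for the difference of two
solutions gives uniqueness.

For (b), solutions are glued along overlaps, and the maximal time is the supremum of all existence
times. For (c), suppose that the maximal time is finite and that the orbit accumulates in `E_μ` at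
some `Y`. Being away from the boundary forces `Y ∈ V`, and the common existence time near `Y`
extends the solution too far. Uniform continuity provides a limit `Y`. In the compact case a bound
in `E_δ` with `δ > μ` gives a subsequence that converges in `E_μ`, by interpolation between `E₀` and
`E_δ`. -/

noncomputable section

namespace QuasiPar

/-! ### Continuous interpolation spaces: embeddings, completeness, interpolation inequality -/

section InterpBasics

variable {E₀ E₁ : Type*} [NormedAddCommGroup E₀] [NormedSpace ℝ E₀]
  [NormedAddCommGroup E₁] [NormedSpace ℝ E₁] {ι : E₁ →L[ℝ] E₀} {θ μ : ℝ}

theorem kFun_le_norm (ι : E₁ →L[ℝ] E₀) {t : ℝ} (ht : 0 < t) (x : E₀) : kFun ι t x ≤ ‖x‖ := by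
  simpa using kFun_le ι ht x 0

theorem kFun_map_le (ι : E₁ →L[ℝ] E₀) {t : ℝ} (ht : 0 < t) (y : E₁) :
    kFun ι t (ι y) ≤ t * ‖y‖ := by
  simpa using kFun_le ι ht (ι y) y

theorem Interp.val_sub (x y : Interp ι θ) : (x - y).val = x.val - y.val := rfl

theorem Interp.kFun_le (x : Interp ι θ) {t : ℝ} (ht : 0 < t) :
    kFun ι t x.val ≤ t ^ θ * ‖x‖ := by
  have h : (t : ℝ) ^ (-θ) * kFun ι t x.val ≤ ‖x‖ := le_ciSup x.bdd ⟨t, ht⟩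
  rwa [Real.rpow_neg ht.le, inv_mul_le_iff₀ (Real.rpow_pos_of_pos ht _)] at h

theorem interpNorm_le_of_kFun_le {x : E₀} {C : ℝ}
    (h : ∀ t > 0, kFun ι t x ≤ t ^ θ * C) : interpNorm ι θ x ≤ C := by
  refine ciSup_le fun t => ?_
  have := h t t.2
  rwa [Real.rpow_neg (le_of_lt t.2), inv_mul_le_iff₀ (Real.rpow_pos_of_pos t.2 _)]

theorem Interp.norm_le_of_kFun_le {x : Interp ι θ} {C : ℝ}
    (h : ∀ t > 0, kFun ι t x.val ≤ t ^ θ * C) : ‖x‖ ≤ C :=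
  interpNorm_le_of_kFun_le h

theorem Interp.norm_val_le (x : Interp ι θ) : ‖x.val‖ ≤ (1 + ‖ι‖) * ‖x‖ := by
  have h := x.kFun_le one_pos
  rw [Real.one_rpow, one_mul] at h
  exact (norm_le_kFun ι x.val).trans (mul_le_mul_of_nonneg_left h (by positivity))

variable (ι θ) in
/-- The inclusion `E_θ → E₀` as a continuous linear map. -/
def Interp.valL : Interp ι θ →L[ℝ] E₀ :=
  LinearMap.mkContinuous ⟨⟨Interp.val, fun _ _ => rfl⟩, fun _ _ => rfl⟩ (1 + ‖ι‖)
    fun x => x.norm_val_le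

theorem Interp.norm_of_le (hθ : θ ∈ Ioo (0 : ℝ) 1) (y : E₁) :
    ‖Interp.of ι hθ y‖ ≤ (1 + ‖ι‖) * ‖y‖ := by
  refine Interp.norm_le_of_kFun_le fun t ht => ?_
  change QuasiPar.kFun ι t (ι y) ≤ _
  rcases le_total t 1 with h | h
  · have h1 : t ≤ t ^ θ := by
      simpa using Real.rpow_le_rpow_of_exponent_ge ht h hθ.2.le
    calc QuasiPar.kFun ι t (ι y) ≤ t * ‖y‖ := kFun_map_le ι ht y
      _ ≤ t ^ θ * ((1 + ‖ι‖) * ‖y‖) := by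
        refine mul_le_mul h1 ?_ (norm_nonneg _) (by positivity)
        nlinarith [norm_nonneg y, norm_nonneg ι, mul_nonneg (norm_nonneg ι) (norm_nonneg y)]
  · have h1 : 1 ≤ t ^ θ := Real.one_le_rpow h hθ.1.le
    calc QuasiPar.kFun ι t (ι y) ≤ 1 * ‖ι y‖ := by simpa using kFun_le_norm ι ht (ι y)
      _ ≤ t ^ θ * ((1 + ‖ι‖) * ‖y‖) := by
        refine mul_le_mul h1 ?_ (norm_nonneg _) (by positivity)
        nlinarith [ι.le_opNorm y, norm_nonneg y]

variable (ι) in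
/-- The embedding `E₁ → E_θ` as a continuous linear map. -/
def Interp.ofL (hθ : θ ∈ Ioo (0 : ℝ) 1) : E₁ →L[ℝ] Interp ι θ :=
  LinearMap.mkContinuous ⟨⟨Interp.of ι hθ, fun x y => Interp.ext (map_add ι x y)⟩,
    fun c x => Interp.ext (map_smul ι c x)⟩ (1 + ‖ι‖) fun x => Interp.norm_of_le hθ x

@[simp] theorem Interp.val_of (hθ : θ ∈ Ioo (0 : ℝ) 1) (y : E₁) :
    (Interp.of ι hθ y).val = ι y := rfl

theorem Interp.of_sub (hθ : θ ∈ Ioo (0 : ℝ) 1) (y z : E₁) :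
    Interp.of ι hθ (y - z) = Interp.of ι hθ y - Interp.of ι hθ z :=
  map_sub (Interp.ofL ι hθ) y z

/-- An element of `E₀` that is approximated by `E_θ` in the norm of `(E₀, E₁)_{θ,∞}` belongs
to `E_θ`. -/
theorem mem_interpSubmodule_of_approx {z : E₀}
    (h : ∀ ε > 0, ∃ x : Interp ι θ, ∀ t > 0, kFun ι t (z - x.val) ≤ t ^ θ * ε) :
    z ∈ interpSubmodule ι θ := by
  have key : ∀ ε > 0, ∃ x : Interp ι θ, ∀ t > 0,
      t ^ (-θ) * kFun ι t z ≤ t ^ (-θ) * kFun ι t x.val + ε := fun ε hε => by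
    obtain ⟨x, hx⟩ := h ε hε
    refine ⟨x, fun t ht => ?_⟩
    have h1 := kFun_add ι ht x.val (z - x.val)
    rw [add_sub_cancel] at h1
    have h2 := hx t ht
    have h3 : t ^ (-θ) * kFun ι t (z - x.val) ≤ ε := by
      rwa [Real.rpow_neg ht.le, inv_mul_le_iff₀ (Real.rpow_pos_of_pos ht _)]
    calc t ^ (-θ) * kFun ι t z
        ≤ t ^ (-θ) * (kFun ι t x.val + kFun ι t (z - x.val)) :=
          mul_le_mul_of_nonneg_left h1 (Real.rpow_nonneg ht.le _)
      _ ≤ _ := by rw [mul_add]; linarith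
  refine ⟨?_, ?_⟩
  · obtain ⟨x, hx⟩ := key 1 one_pos
    obtain ⟨C, hC⟩ := x.bdd
    refine ⟨C + 1, ?_⟩
    rintro _ ⟨t, rfl⟩
    have := hC ⟨t, rfl⟩
    have := hx t t.2
    simp only at *
    linarith
  · rw [Metric.tendsto_nhdsWithin_nhds]
    intro ε hε
    obtain ⟨x, hx⟩ := key (ε / 2) (by linarith)
    obtain ⟨d, hd, h2⟩ := Metric.tendsto_nhdsWithin_nhds.1 x.2.2 (ε / 2) (by linarith)
    refine ⟨d, hd, fun t ht htd => ?_⟩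
    have h3 := h2 ht htd
    have h4 := hx t ht
    have h5 : 0 ≤ t ^ (-θ) * kFun ι t z :=
      mul_nonneg (Real.rpow_nonneg (le_of_lt ht) _) (kFun_nonneg ι ht _)
    rw [Real.dist_eq, sub_zero] at h3 ⊢
    rw [abs_of_nonneg h5]
    have h6 := le_abs_self (t ^ (-θ) * kFun ι t (x : Interp ι θ).val)
    change |t ^ (-θ) * kFun ι t x.val| < ε / 2 at h3
    linarith

/-- A Cauchy sequence of `E_θ` has a limit in `E₀`. For fixed `t` the functional `kFun ι t` is
bounded by the norm of `E₀`, so the Cauchy estimates pass to the limit with constants independent of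
`t`. Hence the limit is approximated in the norm of `E_θ` and belongs to `E_θ`. -/
instance [CompleteSpace E₀] : CompleteSpace (Interp ι θ) := by
  refine Metric.complete_of_cauchySeq_tendsto fun x hx => ?_
  have hx0 : CauchySeq fun n => (x n).val :=
    (Interp.valL ι θ).uniformContinuous.comp_cauchySeq hx
  obtain ⟨z, hz⟩ := cauchySeq_tendsto_of_complete hx0
  have key : ∀ ε > 0, ∃ n₀, ∀ n ≥ n₀, ∀ t > 0, kFun ι t ((x n).val - z) ≤ t ^ θ * ε := by
    intro ε hε
    obtain ⟨n₀, hn₀⟩ := Metric.cauchySeq_iff.1 hx ε hε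
    refine ⟨n₀, fun n hn t ht => ?_⟩
    have h1 : Tendsto (fun m => t ^ θ * ε + ‖(x m).val - z‖) atTop (𝓝 (t ^ θ * ε + 0)) :=
      tendsto_const_nhds.add (tendsto_iff_norm_sub_tendsto_zero.1 hz)
    rw [add_zero] at h1
    refine ge_of_tendsto h1 ?_
    filter_upwards [eventually_ge_atTop n₀] with m hm
    have h2 := kFun_add ι ht ((x n).val - (x m).val) ((x m).val - z)
    rw [sub_add_sub_cancel] at h2
    have h3 := (x n - x m).kFun_le ht
    have h4 : ‖x n - x m‖ ≤ ε := by
      rw [← dist_eq_norm]; exact (hn₀ n hn m hm).le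
    have h5 := mul_le_mul_of_nonneg_left h4 (Real.rpow_nonneg ht.le θ)
    have h6 := kFun_le_norm ι ht ((x m).val - z)
    rw [Interp.val_sub] at h3
    linarith
  have hneg : ∀ t > 0, ∀ a b : E₀, kFun ι t (a - b) ≤ kFun ι t (b - a) := fun t ht a b => by
    simpa using kFun_smul ι ht (-1) (b - a)
  have hmem : z ∈ interpSubmodule ι θ := by
    refine mem_interpSubmodule_of_approx fun ε hε => ?_
    obtain ⟨n₀, h⟩ := key ε hε
    exact ⟨x n₀, fun t ht => (hneg t ht _ _).trans (h n₀ le_rfl t ht)⟩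
  obtain ⟨Z, rfl⟩ : ∃ Z : Interp ι θ, Z.val = z := ⟨⟨z, hmem⟩, rfl⟩
  refine ⟨Z, Metric.tendsto_atTop.2 fun ε hε => ?_⟩
  obtain ⟨n₀, h⟩ := key (ε / 2) (by linarith)
  refine ⟨n₀, fun n hn => ?_⟩
  rw [dist_eq_norm]
  have h1 : ‖x n - Z‖ ≤ ε / 2 := Interp.norm_le_of_kFun_le fun t ht => by
    rw [Interp.val_sub]
    exact h n hn t ht
  linarith

theorem rpow_one_sub_mul_rpow_le {a c d γ : ℝ} (ha : 0 ≤ a) (hab : a ≤ c) (hb : a ≤ d)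
    (hγ : γ ∈ Icc (0 : ℝ) 1) : a ≤ c ^ (1 - γ) * d ^ γ := by
  have h : a = a ^ (1 - γ) * a ^ γ := by
    rw [← Real.rpow_add_of_nonneg ha (by linarith [hγ.2]) hγ.1]; simp
  rw [h]
  exact mul_le_mul (Real.rpow_le_rpow ha hab (by linarith [hγ.2]))
    (Real.rpow_le_rpow ha hb hγ.1) (Real.rpow_nonneg ha _)
    (Real.rpow_nonneg (ha.trans hab) _)

/-- The interpolation inequality between `E_μ` and `E₁`. -/
theorem interpNorm_le_rpow_mul_rpow (hμ : μ ∈ Ioo (0 : ℝ) 1) (hθ : θ ∈ Icc μ 1) (y : E₁) :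
    interpNorm ι θ (ι y) ≤
      ‖Interp.of ι hμ y‖ ^ (1 - (θ - μ) / (1 - μ)) * ‖y‖ ^ ((θ - μ) / (1 - μ)) := by
  have h1μ : 0 < 1 - μ := by linarith [hμ.2]
  set γ := (θ - μ) / (1 - μ) with hγdef
  have hγ : γ ∈ Icc (0 : ℝ) 1 :=
    ⟨div_nonneg (by linarith [hθ.1]) h1μ.le, (div_le_one h1μ).2 (by linarith [hθ.2])⟩
  refine interpNorm_le_of_kFun_le fun t ht => ?_
  have hexp : μ * (1 - γ) + γ = θ := by
    have : γ * (1 - μ) = θ - μ := div_mul_cancel₀ _ h1μ.ne'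
    linarith
  refine (rpow_one_sub_mul_rpow_le (kFun_nonneg ι ht _)
    ((Interp.of ι hμ y).kFun_le ht) (kFun_map_le ι ht y) hγ).trans (le_of_eq ?_)
  rw [Real.mul_rpow (by positivity) (norm_nonneg _), Real.mul_rpow ht.le (norm_nonneg _),
    ← Real.rpow_mul ht.le]
  calc _ = (t ^ (μ * (1 - γ)) * t ^ γ) *
        (‖Interp.of ι hμ y‖ ^ (1 - γ) * ‖y‖ ^ γ) := by ring
    _ = _ := by rw [← Real.rpow_add ht, hexp]

end InterpBasics

/-! ### Functions with a weight at time zero -/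

section WeightedFunctions

set_option linter.unusedSectionVars false

variable {E F : Type*} [NormedAddCommGroup E] [NormedSpace ℝ E]
  [NormedAddCommGroup F] [NormedSpace ℝ F] {μ T : ℝ} {v w : ℝ → E}

theorem Ioc_mem_nhdsGT_zero (hT : 0 < T) : Ioc 0 T ∈ 𝓝[>] (0 : ℝ) := Ioc_mem_nhdsGT hT

theorem continuousOn_rpow_Ioc (p : ℝ) : ContinuousOn (fun t : ℝ => t ^ p) (Ioc 0 T) :=
  fun t ht => (Real.continuousAt_rpow_const t p (Or.inl ht.1.ne')).continuousWithinAt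

theorem tendsto_rpow_zero {p : ℝ} (hp : 0 < p) :
    Tendsto (fun t : ℝ => t ^ p) (𝓝[>] 0) (𝓝 0) := by
  have h := (Real.continuousAt_rpow_const 0 p (Or.inr hp.le)).tendsto.mono_left
    (nhdsWithin_le_nhds (s := Ioi (0 : ℝ)))
  rwa [Real.zero_rpow hp.ne'] at h

/-- The value of `v` at `0` does not matter, since `0 ^ (1 - μ) = 0`. Compactness of `[0,T]` then
makes the boundedness in `MemBC` a consequence of the other two conditions. -/
theorem continuousOn_weight (hμ : μ < 1) (hv : ContinuousOn v (Ioc 0 T))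
    (h0 : Tendsto (fun t : ℝ => t ^ (1 - μ) * ‖v t‖) (𝓝[>] 0) (𝓝 0)) :
    ContinuousOn (fun t : ℝ => t ^ (1 - μ) • v t) (Icc 0 T) := by
  have hz : ((0 : ℝ)) ^ (1 - μ) = 0 := Real.zero_rpow (by linarith)
  intro t ht
  rcases eq_or_lt_of_le ht.1 with rfl | h
  · have h1 : Tendsto (fun t : ℝ => t ^ (1 - μ) • v t) (𝓝[>] 0) (𝓝 0) := by
      rw [tendsto_zero_iff_norm_tendsto_zero]
      refine h0.congr' ?_
      filter_upwards [self_mem_nhdsWithin] with s hs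
      rw [norm_smul, Real.norm_of_nonneg (Real.rpow_nonneg (le_of_lt hs) _)]
    have h2 : ContinuousWithinAt (fun t : ℝ => t ^ (1 - μ) • v t) (Ioi 0) 0 := by
      unfold ContinuousWithinAt; simpa [hz] using h1
    exact (continuousWithinAt_insert_self.2 h2).mono fun s hs => by
      rcases eq_or_lt_of_le hs.1 with h | h
      · exact Or.inl h.symm
      · exact Or.inr h
  · have h1 : ContinuousWithinAt (fun t : ℝ => t ^ (1 - μ) • v t) (Ioc 0 T) t :=
      ((continuousOn_rpow_Ioc _).smul hv) t ⟨h, ht.2⟩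
    refine h1.mono_of_mem_nhdsWithin ?_
    filter_upwards [self_mem_nhdsWithin, mem_nhdsWithin_of_mem_nhds (Ioi_mem_nhds h)]
      with s hs hs' using ⟨hs', hs.2⟩

theorem memBC_of_tendsto (hμ : μ < 1) (hv : ContinuousOn v (Ioc 0 T))
    (h0 : Tendsto (fun t : ℝ => t ^ (1 - μ) * ‖v t‖) (𝓝[>] 0) (𝓝 0)) : MemBC μ T v := by
  refine ⟨hv, ?_, h0⟩
  obtain ⟨C, hC⟩ := isCompact_Icc.exists_bound_of_continuousOn (continuousOn_weight hμ hv h0)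
  refine ⟨C, fun t ht => ?_⟩
  have := hC t ⟨ht.1.le, ht.2⟩
  rwa [norm_smul, Real.norm_of_nonneg (Real.rpow_nonneg ht.1.le _)] at this

theorem MemBC.congr (hv : MemBC μ T v) (hT : 0 < T) (h : EqOn w v (Ioc 0 T)) :
    MemBC μ T w := by
  obtain ⟨h1, ⟨C, hC⟩, h3⟩ := hv
  refine ⟨h1.congr h, ⟨C, fun t ht => by rw [h ht]; exact hC t ht⟩, h3.congr' ?_⟩
  filter_upwards [Ioc_mem_nhdsGT_zero hT] with t ht
  rw [h ht]

theorem MemBC.mono {T' : ℝ} (hv : MemBC μ T v) (h : T' ≤ T) : MemBC μ T' v :=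
  ⟨hv.1.mono (Ioc_subset_Ioc_right h), hv.2.1.imp fun _ hC t ht => hC t ⟨ht.1, ht.2.trans h⟩,
    hv.2.2⟩

theorem MemBC.add (hμ : μ < 1) (hv : MemBC μ T v) (hw : MemBC μ T w) :
    MemBC μ T (fun t => v t + w t) := by
  refine memBC_of_tendsto hμ (hv.1.add hw.1) ?_
  have h := hv.2.2.add hw.2.2
  rw [add_zero] at h
  refine squeeze_zero' ?_ ?_ h
  · filter_upwards [self_mem_nhdsWithin] with t ht
    exact mul_nonneg (Real.rpow_nonneg (le_of_lt ht) _) (norm_nonneg _)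
  · filter_upwards [self_mem_nhdsWithin] with t ht
    rw [← mul_add]
    exact mul_le_mul_of_nonneg_left (norm_add_le _ _) (Real.rpow_nonneg (le_of_lt ht) _)

theorem MemBC.clm (hμ : μ < 1) (hv : MemBC μ T v) (L : E →L[ℝ] F) :
    MemBC μ T (fun t => L (v t)) := by
  refine memBC_of_tendsto hμ (L.continuous.comp_continuousOn hv.1) ?_
  have h := hv.2.2.const_mul ‖L‖
  rw [mul_zero] at h
  refine squeeze_zero' ?_ ?_ h
  · filter_upwards [self_mem_nhdsWithin] with t ht
    exact mul_nonneg (Real.rpow_nonneg (le_of_lt ht) _) (norm_nonneg _)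
  · filter_upwards [self_mem_nhdsWithin] with t ht
    rw [mul_left_comm]
    exact mul_le_mul_of_nonneg_left (L.le_opNorm _) (Real.rpow_nonneg (le_of_lt ht) _)

theorem MemBC.neg (hv : MemBC μ T v) : MemBC μ T (fun t => -v t) := by
  refine ⟨hv.1.neg, ?_⟩
  simpa only [norm_neg] using hv.2

theorem MemBC.sub (hμ : μ < 1) (hv : MemBC μ T v) (hw : MemBC μ T w) :
    MemBC μ T (fun t => v t - w t) := by
  simpa only [sub_eq_add_neg] using hv.add hμ hw.neg

theorem memBC_of_continuousOn_Icc (hμ : μ < 1) (hT : 0 < T) (hv : ContinuousOn v (Icc 0 T)) :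
    MemBC μ T v := by
  refine memBC_of_tendsto hμ (hv.mono Ioc_subset_Icc_self) ?_
  obtain ⟨C, hC⟩ := isCompact_Icc.exists_bound_of_continuousOn hv
  have h := (tendsto_rpow_zero (show 0 < 1 - μ by linarith)).mul_const C
  rw [zero_mul] at h
  refine squeeze_zero' ?_ ?_ h
  · filter_upwards [self_mem_nhdsWithin] with t ht
    exact mul_nonneg (Real.rpow_nonneg (le_of_lt ht) _) (norm_nonneg _)
  · filter_upwards [Ioc_mem_nhdsGT_zero hT] with t ht
    exact mul_le_mul_of_nonneg_left (hC t ⟨ht.1.le, ht.2⟩) (Real.rpow_nonneg ht.1.le _)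

theorem MemBC.shift (hμ : μ < 1) (hv : MemBC μ T v) {a : ℝ} (ha : 0 < a) (haT : a < T) :
    MemBC μ (T - a) (fun t => v (a + t)) :=
  memBC_of_continuousOn_Icc hμ (by linarith) <|
    hv.1.comp (by fun_prop) fun t ht => ⟨by linarith [ht.1], by linarith [ht.2]⟩

/-- The concatenation of `v` on `(-∞, T]` with the translate of `w` by `a`. -/
def glue (a T : ℝ) (v w : ℝ → E) (t : ℝ) : E := if t ≤ T then v t else w (t - a)

theorem glue_of_le {a T t : ℝ} (v w : ℝ → E) (h : t ≤ T) : glue a T v w t = v t := if_pos h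

/-- Since the two pieces agree on the overlap `(a, T]`, the glued function is the translate of `w`
on the whole of `(a, ∞)`. With `a < T` there is then no junction point to be examined separately. -/
theorem glue_of_gt {a T t : ℝ} {v w : ℝ → E} (h : EqOn w (fun s => v (a + s)) (Ioc 0 (T - a)))
    (hat : a < t) : glue a T v w t = w (t - a) := by
  unfold glue
  split_ifs with ht
  · rw [h ⟨by linarith, by linarith⟩]; simp
  · rfl

theorem MemBC.glue (hμ : μ < 1) {a τ : ℝ} (hv : MemBC μ T v) (hw : MemBC μ τ w) (ha : 0 < a)
    (haT : a < T) (h : EqOn w (fun s => v (a + s)) (Ioc 0 (T - a))) :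
    MemBC μ (a + τ) (glue a T v w) := by
  refine memBC_of_tendsto hμ (fun t ht => ?_) (hv.2.2.congr' ?_)
  · rcases lt_or_ge t T with htT | htT
    · have h1 : ContinuousAt v t :=
        (hv.1 t ⟨ht.1, htT.le⟩).continuousAt (Ioc_mem_nhds ht.1 htT)
      refine (h1.congr ?_).continuousWithinAt
      filter_upwards [Iio_mem_nhds htT] with s hs
      exact (glue_of_le _ _ (le_of_lt hs)).symm
    · have hat : a < t := haT.trans_le htT
      have h1 : ContinuousWithinAt (fun s => w (s - a)) (Ioc a (a + τ)) t :=
        ContinuousWithinAt.comp (g := w) (f := fun s => s - a) (t := Ioc 0 τ)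
          (hw.1 (t - a) ⟨by linarith, by linarith [ht.2]⟩) (by fun_prop)
          fun s hs => ⟨by linarith [hs.1], by linarith [hs.2]⟩
      have h2 : ContinuousWithinAt (QuasiPar.glue a T v w) (Ioc a (a + τ)) t :=
        h1.congr (fun s hs => glue_of_gt h hs.1) (glue_of_gt h hat)
      refine h2.mono_of_mem_nhdsWithin ?_
      filter_upwards [self_mem_nhdsWithin, mem_nhdsWithin_of_mem_nhds (Ioi_mem_nhds hat)]
        with s hs hs' using ⟨hs', hs.2⟩
  · filter_upwards [Ioc_mem_nhdsGT_zero (ha.trans haT)] with t ht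
    rw [glue_of_le _ _ ht.2]

theorem norm_le_of_weight {t C : ℝ} {y : E} (ht : 0 < t) (h : t ^ (1 - μ) * ‖y‖ ≤ C) :
    ‖y‖ ≤ C * t ^ (μ - 1) := by
  rw [show μ - 1 = -(1 - μ) by ring, Real.rpow_neg ht.le, ← div_eq_mul_inv,
    le_div_iff₀ (Real.rpow_pos_of_pos ht _), mul_comm]
  exact h

/-- The singularity at `0` is at most of order `t ^ (μ - 1)`, which is integrable because `μ > 0`.
-/
theorem MemBC.intervalIntegrable (hμ : 0 < μ) (hT : 0 < T) (hv : MemBC μ T v) :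
    IntervalIntegrable v MeasureTheory.volume 0 T := by
  obtain ⟨C, hC⟩ := hv.2.1
  have h1 : IntervalIntegrable (fun t : ℝ => C * t ^ (μ - 1)) MeasureTheory.volume 0 T :=
    (intervalIntegral.intervalIntegrable_rpow' (by linarith)).const_mul C
  rw [intervalIntegrable_iff_integrableOn_Ioc_of_le hT.le] at h1 ⊢
  refine MeasureTheory.Integrable.mono' h1 (hv.1.aestronglyMeasurable measurableSet_Ioc) ?_
  rw [MeasureTheory.ae_restrict_iff' measurableSet_Ioc]
  exact Eventually.of_forall fun t ht => norm_le_of_weight ht.1 (hC t ht)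

theorem MemBC.intervalIntegrable_of_mem (hμ : 0 < μ) (hT : 0 < T) (hv : MemBC μ T v) {a b : ℝ}
    (ha : a ∈ Icc 0 T) (hb : b ∈ Icc 0 T) : IntervalIntegrable v MeasureTheory.volume a b :=
  (hv.intervalIntegrable hμ hT).mono_set (by
    rw [uIcc_of_le hT.le]; exact uIcc_subset_Icc ha hb)

theorem norm_integral_le_of_weight (hμ : 0 < μ) {t C : ℝ} (ht : 0 ≤ t)
    (h : ∀ s ∈ Ioc 0 t, s ^ (1 - μ) * ‖v s‖ ≤ C) : ‖∫ s in (0 : ℝ)..t, v s‖ ≤ C / μ * t ^ μ := by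
  have h1 : IntervalIntegrable (fun t : ℝ => C * t ^ (μ - 1)) MeasureTheory.volume 0 t :=
    (intervalIntegral.intervalIntegrable_rpow' (by linarith)).const_mul C
  refine (intervalIntegral.norm_integral_le_of_norm_le ht (Eventually.of_forall
    fun s hs => norm_le_of_weight hs.1 (h s hs)) h1).trans (le_of_eq ?_)
  rw [intervalIntegral.integral_const_mul, integral_rpow (Or.inl (by linarith))]
  simp only [sub_add_cancel, Real.zero_rpow hμ.ne']
  ring

end WeightedFunctions

/-! ### The integrated equation and the trace estimate -/

section IntegralEquation

variable {E₀ E₁ : Type*} [NormedAddCommGroup E₀] [NormedSpace ℝ E₀]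
  [NormedAddCommGroup E₁] [NormedSpace ℝ E₁] {ι : E₁ →L[ℝ] E₀} {μ T : ℝ}
  {x : E₀} {u : ℝ → E₁} {f : ℝ → E₀}

variable (ι μ) in
/-- The integrated form of `u' = f` on `(0,T]`, `u(0) = x`, for `u` and `f` in the weighted
spaces. -/
structure IntEq (T : ℝ) (x : E₀) (u : ℝ → E₁) (f : ℝ → E₀) : Prop where
  memBC : MemBC μ T u
  memBC_deriv : MemBC μ T f
  eq : ∀ t ∈ Ioc 0 T, ι (u t) = x + ∫ s in (0 : ℝ)..t, f s

theorem IntEq.mono {T' : ℝ} (h : IntEq ι μ T x u f) (hT : T' ≤ T) : IntEq ι μ T' x u f :=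
  ⟨h.memBC.mono hT, h.memBC_deriv.mono hT, fun t ht => h.eq t ⟨ht.1, ht.2.trans hT⟩⟩

theorem IntEq.congr {u' : ℝ → E₁} {f' : ℝ → E₀} (h : IntEq ι μ T x u f) (hT : 0 < T)
    (hu : EqOn u' u (Ioc 0 T)) (hf : EqOn f' f (Ioc 0 T)) : IntEq ι μ T x u' f' := by
  refine ⟨h.memBC.congr hT hu, h.memBC_deriv.congr hT hf, fun t ht => ?_⟩
  rw [hu ht, h.eq t ht]
  congr 1
  refine intervalIntegral.integral_congr_ae (Eventually.of_forall fun s hs => ?_)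
  rw [uIoc_of_le ht.1.le] at hs
  exact (hf ⟨hs.1, hs.2.trans ht.2⟩).symm

theorem IntEq.add {y : E₀} {w : ℝ → E₁} {g : ℝ → E₀} (hμ : μ ∈ Ioo (0 : ℝ) 1)
    (h : IntEq ι μ T x u f) (h' : IntEq ι μ T y w g) :
    IntEq ι μ T (x + y) (fun t => u t + w t) (fun t => f t + g t) := by
  refine ⟨h.memBC.add hμ.2 h'.memBC, h.memBC_deriv.add hμ.2 h'.memBC_deriv, fun t ht => ?_⟩
  have hT : 0 < T := ht.1.trans_le ht.2
  rw [map_add, h.eq t ht, h'.eq t ht, intervalIntegral.integral_add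
    (h.memBC_deriv.intervalIntegrable_of_mem hμ.1 hT ⟨le_rfl, hT.le⟩ ⟨ht.1.le, ht.2⟩)
    (h'.memBC_deriv.intervalIntegrable_of_mem hμ.1 hT ⟨le_rfl, hT.le⟩ ⟨ht.1.le, ht.2⟩)]
  abel

theorem IntEq.neg (h : IntEq ι μ T x u f) :
    IntEq ι μ T (-x) (fun t => -u t) (fun t => -f t) :=
  ⟨h.memBC.neg, h.memBC_deriv.neg, fun t ht => by
    rw [map_neg, h.eq t ht, intervalIntegral.integral_neg, neg_add]⟩

theorem IntEq.sub {y : E₀} {w : ℝ → E₁} {g : ℝ → E₀} (hμ : μ ∈ Ioo (0 : ℝ) 1)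
    (h : IntEq ι μ T x u f) (h' : IntEq ι μ T y w g) :
    IntEq ι μ T (x - y) (fun t => u t - w t) (fun t => f t - g t) := by
  simpa only [sub_eq_add_neg] using h.add hμ h'.neg

theorem IntEq.shift (hμ : μ ∈ Ioo (0 : ℝ) 1) (h : IntEq ι μ T x u f) {a : ℝ} (ha : 0 < a)
    (haT : a < T) :
    IntEq ι μ (T - a) (ι (u a)) (fun t => u (a + t)) (fun t => f (a + t)) := by
  have hT : 0 < T := ha.trans haT
  refine ⟨h.memBC.shift hμ.2 ha haT, h.memBC_deriv.shift hμ.2 ha haT, fun t ht => ?_⟩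
  have h1 : a + t ∈ Ioc 0 T := ⟨by linarith [ht.1], by linarith [ht.2]⟩
  rw [h.eq a ⟨ha, haT.le⟩, h.eq _ h1, intervalIntegral.integral_comp_add_left, add_zero, add_assoc,
    intervalIntegral.integral_add_adjacent_intervals
      (h.memBC_deriv.intervalIntegrable_of_mem hμ.1 hT ⟨le_rfl, hT.le⟩ ⟨ha.le, haT.le⟩)
      (h.memBC_deriv.intervalIntegrable_of_mem hμ.1 hT ⟨ha.le, haT.le⟩ ⟨h1.1.le, h1.2⟩)]

theorem IntEq.glue (hμ : μ ∈ Ioo (0 : ℝ) 1) {a τ : ℝ} {w : ℝ → E₁} {g : ℝ → E₀}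
    (h : IntEq ι μ T x u f) (h' : IntEq ι μ τ (ι (u a)) w g) (ha : 0 < a) (haT : a < T)
    (hw : EqOn w (fun s => u (a + s)) (Ioc 0 (T - a)))
    (hg : EqOn g (fun s => f (a + s)) (Ioc 0 (T - a))) :
    IntEq ι μ (a + τ) x (glue a T u w) (glue a T f g) := by
  have hmem := h.memBC_deriv.glue hμ.2 h'.memBC_deriv ha haT hg
  refine ⟨h.memBC.glue hμ.2 h'.memBC ha haT hw, hmem, fun t ht => ?_⟩
  have hT : 0 < a + τ := ht.1.trans_le ht.2
  have hlow : ∀ r ≤ T, 0 < r → ∫ s in (0 : ℝ)..r, QuasiPar.glue a T f g s =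
      ∫ s in (0 : ℝ)..r, f s := fun r hr hr0 => by
    refine intervalIntegral.integral_congr_ae (Eventually.of_forall fun s hs => ?_)
    rw [uIoc_of_le hr0.le] at hs
    exact glue_of_le _ _ (hs.2.trans hr)
  rcases le_or_gt t T with htT | htT
  · rw [glue_of_le _ _ htT, h.eq t ⟨ht.1, htT⟩, hlow t htT ht.1]
  · have hat : a < t := haT.trans htT
    rw [glue_of_gt hw hat, h'.eq (t - a) ⟨by linarith, by linarith [ht.2]⟩,
      h.eq a ⟨ha, haT.le⟩, ← hlow a haT.le ha, add_assoc,
      ← intervalIntegral.integral_add_adjacent_intervals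
      (hmem.intervalIntegrable_of_mem hμ.1 hT ⟨le_rfl, hT.le⟩ ⟨ha.le, hat.le.trans ht.2⟩)
      (hmem.intervalIntegrable_of_mem hμ.1 hT ⟨ha.le, hat.le.trans ht.2⟩ ⟨ht.1.le, ht.2⟩)]
    congr 2
    rw [← sub_self a, ← intervalIntegral.integral_comp_sub_right g a]
    refine intervalIntegral.integral_congr_ae (Eventually.of_forall fun s hs => ?_)
    rw [uIoc_of_le hat.le] at hs
    exact (glue_of_gt hg hs.1).symm

theorem IntEq.norm_sub_le (hμ : 0 < μ) (h : IntEq ι μ T x u f) {t C : ℝ} (ht : t ∈ Ioc 0 T)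
    (hf : ∀ s ∈ Ioc 0 t, s ^ (1 - μ) * ‖f s‖ ≤ C) : ‖ι (u t) - x‖ ≤ C / μ * t ^ μ := by
  rw [h.eq t ht, add_sub_cancel_left]
  exact norm_integral_le_of_weight hμ ht.1.le hf

/-- The trace estimate: functions in `𝔼_{1,μ}` deviate from their initial value in the norm of
`E_μ` by at most a multiple of their norm in `𝔼_{1,μ}`. -/
theorem IntEq.norm_of_sub_le (hμ : μ ∈ Ioo (0 : ℝ) 1) {X : Interp ι μ}
    (h : IntEq ι μ T X.val u f) {t C : ℝ} (ht : t ∈ Ioc 0 T)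
    (hu : ∀ s ∈ Ioc 0 t, s ^ (1 - μ) * ‖u s‖ ≤ C)
    (hf : ∀ s ∈ Ioc 0 t, s ^ (1 - μ) * ‖f s‖ ≤ C) :
    ‖Interp.of ι hμ (u t) - X‖ ≤ (2 + 1 / μ) * C := by
  have hC : 0 ≤ C := le_trans (mul_nonneg (Real.rpow_nonneg ht.1.le _) (norm_nonneg _))
    (hu t ⟨ht.1, le_rfl⟩)
  refine Interp.norm_le_of_kFun_le fun s hs => ?_
  rw [Interp.val_sub, Interp.val_of]
  -- For `s ≥ t` the whole difference is measured in `E₀`. For `s < t` it is split at time `s`: `u t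
  -- - u s` is taken in `E₁`, where the weight gives `s ^ (μ - 1)`, and `ι (u s) - X` in `E₀`.
  rcases le_or_gt t s with hts | hts
  · calc kFun ι s (ι (u t) - X.val) ≤ ‖ι (u t) - X.val‖ := kFun_le_norm ι hs _
      _ ≤ C / μ * t ^ μ := h.norm_sub_le hμ.1 ht hf
      _ ≤ C / μ * s ^ μ := mul_le_mul_of_nonneg_left (Real.rpow_le_rpow ht.1.le hts hμ.1.le)
          (div_nonneg hC hμ.1.le)
      _ ≤ s ^ μ * ((2 + 1 / μ) * C) := by
          have := mul_nonneg (Real.rpow_nonneg hs.le μ) hC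
          have h2 : C / μ * s ^ μ = s ^ μ * (1 / μ * C) := by ring
          rw [h2]
          nlinarith
  · have h1 := h.norm_sub_le hμ.1 ⟨hs, hts.le.trans ht.2⟩ fun r hr => hf r ⟨hr.1, hr.2.trans hts.le⟩
    have h2 : ‖u t‖ ≤ C * s ^ (μ - 1) := (norm_le_of_weight ht.1 (hu t ⟨ht.1, le_rfl⟩)).trans
      (mul_le_mul_of_nonneg_left (Real.rpow_le_rpow_of_nonpos hs hts.le (by linarith [hμ.2])) hC)
    have h3 : ‖u s‖ ≤ C * s ^ (μ - 1) := norm_le_of_weight hs (hu s ⟨hs, hts.le⟩)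
    have h4 : s * s ^ (μ - 1) = s ^ μ := by
      rw [mul_comm, ← Real.rpow_add_one hs.ne', sub_add_cancel]
    have h5 := kFun_add ι hs (ι (u t - u s)) (ι (u s) - X.val)
    rw [map_sub, sub_add_sub_cancel, ← map_sub] at h5
    have h6 := kFun_map_le ι hs (u t - u s)
    have h7 := kFun_le_norm ι hs (ι (u s) - X.val)
    have h8 := mul_le_mul_of_nonneg_left ((_root_.norm_sub_le (u t) (u s)).trans (add_le_add h2 h3)) hs.le
    calc kFun ι s (ι (u t) - X.val) ≤ s * (C * s ^ (μ - 1) + C * s ^ (μ - 1)) + C / μ * s ^ μ := by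
          linarith
      _ = 2 * C * (s * s ^ (μ - 1)) + C / μ * s ^ μ := by ring
      _ = s ^ μ * ((2 + 1 / μ) * C) := by rw [h4]; ring

theorem IntEq.tendsto_of (hμ : μ ∈ Ioo (0 : ℝ) 1) (hT : 0 < T) {X : Interp ι μ}
    (h : IntEq ι μ T X.val u f) :
    Tendsto (fun t => Interp.of ι hμ (u t)) (𝓝[>] 0) (𝓝 X) := by
  rw [Metric.tendsto_nhdsWithin_nhds]
  intro ε hε
  have hc : 0 < 2 + 1 / μ := by have := hμ.1; positivity
  set C := ε / (2 * (2 + 1 / μ)) with hCdef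
  have hC : 0 < C := by positivity
  obtain ⟨d, hd, h1⟩ := Metric.tendsto_nhdsWithin_nhds.1 h.memBC.2.2 C hC
  obtain ⟨e, he, h2⟩ := Metric.tendsto_nhdsWithin_nhds.1 h.memBC_deriv.2.2 C hC
  refine ⟨min (min d e) T, by positivity, fun t ht htd => ?_⟩
  rw [Real.dist_eq, sub_zero, abs_of_pos ht, lt_min_iff, lt_min_iff] at htd
  have key : ∀ {d : ℝ} {q : ℝ → ℝ}, (∀ s, 0 < s → s < d → dist (q s) 0 < C) →
      t < d → ∀ s ∈ Ioc 0 t, q s ≤ C := fun hq htd s hs => by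
    have := hq s hs.1 (hs.2.trans_lt htd)
    rw [Real.dist_eq, sub_zero] at this
    exact (le_abs_self _).trans this.le
  have h3 := h.norm_of_sub_le hμ ⟨ht, htd.2.le⟩
    (key (fun s hs hsd => h1 hs (by rwa [Real.dist_eq, sub_zero, abs_of_pos hs])) htd.1.1)
    (key (fun s hs hsd => h2 hs (by rwa [Real.dist_eq, sub_zero, abs_of_pos hs])) htd.1.2)
  rw [dist_eq_norm]
  refine h3.trans_lt ?_
  rw [hCdef]
  field_simp
  linarith

theorem IntEq.hasTrace (hμ : μ ∈ Ioo (0 : ℝ) 1) (hT : 0 < T) (h : IntEq ι μ T x u f) :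
    HasTrace ι u x := by
  obtain ⟨C, hC⟩ := h.memBC_deriv.2.1
  have h1 := (tendsto_rpow_zero hμ.1).const_mul (C / μ)
  rw [mul_zero] at h1
  refine tendsto_iff_norm_sub_tendsto_zero.2 (squeeze_zero' (Eventually.of_forall fun _ =>
    norm_nonneg _) ?_ h1)
  filter_upwards [Ioc_mem_nhdsGT_zero hT] with t ht
  exact h.norm_sub_le hμ.1 ht fun s hs => hC s ⟨hs.1, hs.2.trans ht.2⟩

variable [CompleteSpace E₀]

theorem IntEq.hasDerivWithinAt (hμ : μ ∈ Ioo (0 : ℝ) 1) (h : IntEq ι μ T x u f) {t : ℝ}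
    (ht : t ∈ Ioc 0 T) : HasDerivWithinAt (fun s => ι (u s)) (f t) (Ioc 0 T) t := by
  have hT : 0 < T := ht.1.trans_le ht.2
  have hsub : Icc (t / 2) T ⊆ Ioc 0 T := fun s hs => ⟨by linarith [hs.1, ht.1], hs.2⟩
  have : Fact (t ∈ Icc (t / 2) T) := ⟨⟨by linarith [ht.1], ht.2⟩⟩
  have hc : ContinuousOn f (Icc (t / 2) T) := h.memBC_deriv.1.mono hsub
  have h1 : HasDerivWithinAt (fun r => ∫ s in (0 : ℝ)..r, f s) (f t) (Icc (t / 2) T) t :=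
    intervalIntegral.integral_hasDerivWithinAt_right
      (h.memBC_deriv.intervalIntegrable_of_mem hμ.1 hT ⟨le_rfl, hT.le⟩ ⟨ht.1.le, ht.2⟩)
      (hc.stronglyMeasurableAtFilter_nhdsWithin measurableSet_Icc t)
      (hc t Fact.out)
  refine HasDerivWithinAt.mono_of_mem_nhdsWithin (t := Icc (t / 2) T)
    ((h1.const_add x).congr (fun s hs => h.eq s (hsub hs)) (h.eq t ht)) ?_
  filter_upwards [self_mem_nhdsWithin,
    mem_nhdsWithin_of_mem_nhds (Ioi_mem_nhds (show t / 2 < t by linarith [ht.1]))]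
    with s hs hs' using ⟨le_of_lt hs', hs.2⟩

theorem IntEq.dt_eq (hμ : μ ∈ Ioo (0 : ℝ) 1) (h : IntEq ι μ T x u f) {t : ℝ}
    (ht : t ∈ Ioc 0 T) : dt ι T u t = f t :=
  (h.hasDerivWithinAt hμ ht).derivWithin (uniqueDiffOn_Ioc 0 T t ht)

theorem IntEq.memE1 (hμ : μ ∈ Ioo (0 : ℝ) 1) (hT : 0 < T) (h : IntEq ι μ T x u f) :
    MemE1 ι μ T u :=
  ⟨⟨fun _ ht => (h.hasDerivWithinAt hμ ht).differentiableWithinAt, h.memBC.clm hμ.2 ι,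
    h.memBC_deriv.congr hT fun _ ht => h.dt_eq hμ ht⟩, h.memBC⟩

/-- The fundamental theorem of calculus on `(0,t)`: the derivative is integrable up to `0`, and the
trace supplies the boundary value there. -/
theorem IntEq.of_memE1 (hμ : μ ∈ Ioo (0 : ℝ) 1) (hT : 0 < T) (hu : MemE1 ι μ T u)
    (hx : HasTrace ι u x) (hf : ∀ t ∈ Ioc 0 T, dt ι T u t = f t) : IntEq ι μ T x u f := by
  have hmem : MemBC μ T f := hu.1.2.2.congr hT fun t ht => (hf t ht).symm
  refine ⟨hu.2, hmem, fun t ht => ?_⟩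
  have hcont : ContinuousWithinAt (fun s => ι (u s)) (Iio t) t :=
    (hu.1.1.continuousOn t ht).mono_of_mem_nhdsWithin (by
      filter_upwards [self_mem_nhdsWithin, mem_nhdsWithin_of_mem_nhds (Ioi_mem_nhds ht.1)]
        with s hs hs' using ⟨hs', (le_of_lt hs).trans ht.2⟩)
  rw [intervalIntegral.integral_eq_sub_of_hasDerivAt_of_tendsto ht.1 (fun s hs => ?_)
    (hmem.intervalIntegrable_of_mem hμ.1 hT ⟨le_rfl, hT.le⟩ ⟨ht.1.le, ht.2⟩) hx hcont]
  · abel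
  · have hs' : s ∈ Ioc 0 T := ⟨hs.1, hs.2.le.trans ht.2⟩
    have h1 := (hu.1.1 s hs').hasDerivWithinAt
    rw [← hf s hs']
    exact h1.hasDerivAt (Ioc_mem_nhds hs.1 (hs.2.trans_le ht.2))

end IntegralEquation

/-! ### The weighted functions as a Banach space -/

section WeightedSpace

open scoped BoundedContinuousFunction

variable {E : Type*} [NormedAddCommGroup E] [NormedSpace ℝ E] {μ T τ : ℝ}

/-- The bounded continuous functions on `ℝ` that vanish on `(-∞, 0]` and are constant on
`[T, ∞)`. Multiplication by `t ^ (1-μ)` identifies `BC_{1-μ}([0,T], E)` with this space. -/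
def wSpace (T : ℝ) (E : Type*) [NormedAddCommGroup E] [NormedSpace ℝ E] :
    Submodule ℝ (ℝ →ᵇ E) where
  carrier := {g | (∀ t ≤ 0, g t = 0) ∧ ∀ t ≥ T, g t = g T}
  zero_mem' := ⟨fun _ _ => rfl, fun _ _ => rfl⟩
  add_mem' := fun {f g} hf hg =>
    ⟨fun t ht => by simp [hf.1 t ht, hg.1 t ht], fun t ht => by simp [hf.2 t ht, hg.2 t ht]⟩
  smul_mem' := fun c g hg =>
    ⟨fun t ht => by simp [hg.1 t ht], fun t ht => by simp [hg.2 t ht]⟩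

theorem isClosed_wSpace : IsClosed (wSpace T E : Set (ℝ →ᵇ E)) := by
  have hc : ∀ t, Continuous fun g : ℝ →ᵇ E => g t := fun t =>
    (BoundedContinuousFunction.evalCLM ℝ t).continuous
  have h : (wSpace T E : Set (ℝ →ᵇ E)) =
      (⋂ t : Iic (0 : ℝ), {g | g t = 0}) ∩ ⋂ t : Ici T, {g | g t = g T} := by
    ext g
    simp [wSpace]
  rw [h]
  exact (isClosed_iInter fun t : Iic (0 : ℝ) => isClosed_eq (hc t) continuous_const).inter
    (isClosed_iInter fun t : Ici T => isClosed_eq (hc t) (hc T))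

instance [CompleteSpace E] : CompleteSpace (wSpace T E) := isClosed_wSpace.completeSpace_coe

/-- The function with weighted counterpart `g`. -/
def unw (μ : ℝ) (g : wSpace T E) (t : ℝ) : E := t ^ (μ - 1) • g.1 t

theorem unw_sub (g h : wSpace T E) (t : ℝ) : unw μ (g - h) t = unw μ g t - unw μ h t :=
  smul_sub _ _ _

theorem weight_mul_rpow {t : ℝ} (ht : 0 < t) : t ^ (1 - μ) * t ^ (μ - 1) = 1 := by
  rw [← Real.rpow_add ht]; simp

theorem wSpace.norm_apply_le (g : wSpace T E) (t : ℝ) : ‖g.1 t‖ ≤ ‖g‖ := g.1.norm_coe_le_norm t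

theorem weight_norm_unw (g : wSpace T E) {t : ℝ} (ht : 0 < t) :
    t ^ (1 - μ) * ‖unw μ g t‖ = ‖g.1 t‖ := by
  rw [unw, norm_smul, Real.norm_of_nonneg (Real.rpow_nonneg ht.le _), ← mul_assoc,
    weight_mul_rpow ht, one_mul]

theorem memBC_unw (hμ : μ < 1) (g : wSpace T E) (τ : ℝ) : MemBC μ τ (unw μ g) := by
  refine memBC_of_tendsto hμ ((continuousOn_rpow_Ioc _).smul g.1.continuous.continuousOn) ?_
  have h : Tendsto (fun t => ‖g.1 t‖) (𝓝[>] 0) (𝓝 0) := by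
    have := (g.1.continuous.norm.tendsto 0).mono_left (nhdsWithin_le_nhds (s := Ioi (0 : ℝ)))
    rwa [g.2.1 0 le_rfl, norm_zero] at this
  refine h.congr' ?_
  filter_upwards [self_mem_nhdsWithin] with t ht using (weight_norm_unw g ht).symm

/-- The projection of `ℝ` onto `[0,τ]`. -/
def clamp (τ t : ℝ) : ℝ := max 0 (min t τ)

theorem clamp_mem (hτ : 0 ≤ τ) (t : ℝ) : clamp τ t ∈ Icc 0 τ :=
  ⟨le_max_left _ _, max_le hτ (min_le_right _ _)⟩

theorem clamp_of_mem {t : ℝ} (ht : t ∈ Icc 0 τ) : clamp τ t = t := by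
  simp [clamp, ht.1, ht.2]

/-- The weighted counterpart of a function on `(0,τ]`, `τ ≤ T`. -/
def toW (hμ : μ < 1) (hτ : 0 < τ) (hT : τ ≤ T) (v : ℝ → E) (hv : MemBC μ τ v) : wSpace T E :=
  ⟨BoundedContinuousFunction.ofNormedAddCommGroup
    (fun t => clamp τ t ^ (1 - μ) • v (clamp τ t))
    ((continuousOn_weight hμ hv.1 hv.2.2).comp_continuous (by unfold clamp; fun_prop)
      (clamp_mem hτ.le))
    (max 0 hv.2.1.choose) fun t => by
      have h := hv.2.1.choose_spec
      have h1 := clamp_mem hτ.le t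
      rcases eq_or_lt_of_le h1.1 with h0 | h0
      · rw [← h0, Real.zero_rpow (by linarith), zero_smul, norm_zero]
        exact le_max_left _ _
      · rw [norm_smul, Real.norm_of_nonneg (Real.rpow_nonneg h1.1 _)]
        exact (h _ ⟨h0, h1.2⟩).trans (le_max_right _ _),
  fun t ht => by
    have h : clamp τ t = 0 := by simp [clamp, ht]
    simp [h, Real.zero_rpow (show 1 - μ ≠ 0 by linarith)],
  fun t ht => by
    have h : clamp τ t = clamp τ T := by
      simp [clamp, hT, hT.trans ht]
    simp [h]⟩

theorem toW_apply (hμ : μ < 1) (hτ : 0 < τ) (hT : τ ≤ T) {v : ℝ → E} (hv : MemBC μ τ v) (t : ℝ) :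
    (toW hμ hτ hT v hv).1 t = clamp τ t ^ (1 - μ) • v (clamp τ t) := rfl

theorem unw_toW (hμ : μ < 1) (hτ : 0 < τ) (hT : τ ≤ T) {v : ℝ → E} (hv : MemBC μ τ v) :
    EqOn (unw μ (toW hμ hτ hT v hv)) v (Ioc 0 τ) := fun t ht => by
  rw [unw, toW_apply, clamp_of_mem ⟨ht.1.le, ht.2⟩, smul_smul, mul_comm, weight_mul_rpow ht.1,
    one_smul]

/-- Beyond `τ` the weighted function is continued by its value at `τ`, so the passage from `(0,τ]`
to `(0,T]` does not increase norms. One solution operator on the fixed interval `[0,T]` thus serves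
all `τ ≤ T`, with a bound independent of `τ`. -/
theorem norm_toW_sub_le (hμ : μ < 1) (hτ : 0 < τ) (hT : τ ≤ T) {v w : ℝ → E}
    (hv : MemBC μ τ v) (hw : MemBC μ τ w) {C : ℝ} (hC : 0 ≤ C)
    (h : ∀ t ∈ Ioc 0 τ, t ^ (1 - μ) * ‖v t - w t‖ ≤ C) :
    ‖toW hμ hτ hT v hv - toW hμ hτ hT w hw‖ ≤ C := by
  refine (BoundedContinuousFunction.norm_le hC).2 fun t => ?_
  change ‖clamp τ t ^ (1 - μ) • v (clamp τ t) - clamp τ t ^ (1 - μ) • w (clamp τ t)‖ ≤ C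
  have h1 := clamp_mem hτ.le t
  rw [← smul_sub, norm_smul, Real.norm_of_nonneg (Real.rpow_nonneg h1.1 _)]
  rcases eq_or_lt_of_le h1.1 with h0 | h0
  · rw [← h0, Real.zero_rpow (by linarith), zero_mul]
    exact hC
  · exact h _ ⟨h0, h1.2⟩

theorem norm_toW_le (hμ : μ < 1) (hτ : 0 < τ) (hT : τ ≤ T) {v : ℝ → E}
    (hv : MemBC μ τ v) {C : ℝ} (hC : 0 ≤ C)
    (h : ∀ t ∈ Ioc 0 τ, t ^ (1 - μ) * ‖v t‖ ≤ C) : ‖toW hμ hτ hT v hv‖ ≤ C := by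
  refine (BoundedContinuousFunction.norm_le hC).2 fun t => ?_
  change ‖clamp τ t ^ (1 - μ) • v (clamp τ t)‖ ≤ C
  have h1 := clamp_mem hτ.le t
  rw [norm_smul, Real.norm_of_nonneg (Real.rpow_nonneg h1.1 _)]
  rcases eq_or_lt_of_le h1.1 with h0 | h0
  · rw [← h0, Real.zero_rpow (by linarith), zero_mul]
    exact hC
  · exact h _ ⟨h0, h1.2⟩

/-- The primitive at time `t` of the function with weighted counterpart `g`. -/
def primL (hμ : μ ∈ Ioo (0 : ℝ) 1) (T : ℝ) {t : ℝ} (ht : 0 < t) : wSpace T E →L[ℝ] E :=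
  LinearMap.mkContinuous
    { toFun := fun g => ∫ s in (0 : ℝ)..t, unw μ g s
      map_add' := fun g h => by
        rw [← intervalIntegral.integral_add ((memBC_unw hμ.2 g t).intervalIntegrable hμ.1 ht)
          ((memBC_unw hμ.2 h t).intervalIntegrable hμ.1 ht)]
        congr 1
        ext s
        exact smul_add _ _ _
      map_smul' := fun c g => by
        rw [RingHom.id_apply, ← intervalIntegral.integral_smul]
        congr 1
        ext s
        exact smul_comm _ _ _ }
    (1 / μ * t ^ μ) fun g => by
      refine (norm_integral_le_of_weight (μ := μ) (C := ‖g‖) hμ.1 ht.le fun s hs => ?_).trans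
        (le_of_eq (by ring))
      rw [weight_norm_unw g hs.1]
      exact wSpace.norm_apply_le g s

end WeightedSpace

/-- A closed linear relation between Banach spaces that is the graph of a function is the graph of
a bounded operator. -/
theorem exists_clm_of_isClosed_graph {X Y : Type*} [NormedAddCommGroup X] [NormedSpace ℝ X]
    [CompleteSpace X] [NormedAddCommGroup Y] [NormedSpace ℝ Y] [CompleteSpace Y]
    (Z : Submodule ℝ (Y × X)) (hZ : IsClosed (Z : Set (Y × X)))
    (hu : ∀ p q q', (q, p) ∈ Z → (q', p) ∈ Z → q = q') (hs : ∀ p, ∃ q, (q, p) ∈ Z) :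
    ∃ S : X →L[ℝ] Y, ∀ p, (S p, p) ∈ Z := by
  have hCZ : CompleteSpace Z := hZ.completeSpace_coe
  let P : Z →L[ℝ] X := (ContinuousLinearMap.snd ℝ Y X).comp Z.subtypeL
  have hPi : Function.Injective P := by
    rintro ⟨⟨q, p⟩, hz⟩ ⟨⟨q', p'⟩, hz'⟩ h
    change p = p' at h
    subst h
    have := hu _ _ _ hz hz'
    subst this
    rfl
  have hPs : Function.Surjective P := fun p =>
    let ⟨q, hq⟩ := hs p
    ⟨⟨(q, p), hq⟩, rfl⟩
  let e : Z ≃L[ℝ] X := ContinuousLinearEquiv.ofBijective P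
    (LinearMap.ker_eq_bot (f := (P : Z →ₗ[ℝ] X)).2 hPi)
    (LinearMap.range_eq_top (f := (P : Z →ₗ[ℝ] X)).2 hPs)
  have he : ∀ p, (e.symm p).1.2 = p := fun p => e.apply_symm_apply p
  refine ⟨(ContinuousLinearMap.fst ℝ Y X).comp (Z.subtypeL.comp (e.symm : X →L[ℝ] Z)),
    fun p => ?_⟩
  have h : (e.symm p).1 = ((e.symm p).1.1, p) := Prod.ext rfl (he p)
  have h' := (e.symm p).2
  rw [h] at h'
  exact h'

/-! ### Maximal regularity and the linear solution operator -/

section Linear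

set_option linter.unusedSectionVars false

variable {E₀ E₁ : Type*} [NormedAddCommGroup E₀] [NormedSpace ℝ E₀] [CompleteSpace E₀]
  [NormedAddCommGroup E₁] [NormedSpace ℝ E₁] [CompleteSpace E₁]
  {ι : E₁ →L[ℝ] E₀} {μ T τ : ℝ} {B : E₁ →L[ℝ] E₀}

theorem maxReg_iff (hμ : μ ∈ Ioo (0 : ℝ) 1) : B ∈ maxReg ι μ ↔ ∃ T : ℝ, 0 < T ∧
    ∀ f : ℝ → E₀, MemBC μ T f → ∀ x : Interp ι μ,
      ∃ u, IntEq ι μ T x.val u (fun t => f t - B (u t)) ∧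
        ∀ v, IntEq ι μ T x.val v (fun t => f t - B (v t)) → EqOn v u (Ioc 0 T) := by
  have key : ∀ T : ℝ, 0 < T → ∀ (f : ℝ → E₀) (x : Interp ι μ) (u : ℝ → E₁),
      (MemE1 ι μ T u ∧ (∀ t ∈ Ioc 0 T, dt ι T u t + B (u t) = f t) ∧ HasTrace ι u x.val) ↔
      IntEq ι μ T x.val u (fun t => f t - B (u t)) := fun T hT f x u =>
    ⟨fun h => IntEq.of_memE1 hμ hT h.1 h.2.2 fun t ht => by
        rw [← h.2.1 t ht, add_sub_cancel_right],
      fun h => ⟨h.memE1 hμ hT, fun t ht => by rw [h.dt_eq hμ ht, sub_add_cancel],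
        h.hasTrace hμ hT⟩⟩
  unfold maxReg
  refine exists_congr fun T => and_congr_right fun hT => forall_congr' fun f =>
    forall_congr' fun _ => forall_congr' fun x => ?_
  simp only [key T hT f x]

/-- Maximal regularity speaks of one interval `[0,T]` only. A solution on the shorter `[0,τ]` with
zero data is delayed by `T - τ` and preceded by zero. As `v` may be singular at `0`, this is done
with its primitive `V`, which is continuous in `E₁`, vanishes at `0` and solves the same homogeneous
equation. So `V = 0`, hence `ι (v t) = -B (V t) = 0`. -/
theorem intEq_zero_unique (hinj : Function.Injective ι) (hμ : μ ∈ Ioo (0 : ℝ) 1) (hτ : 0 < τ)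
    (hτT : τ ≤ T)
    (hT : ∀ w : ℝ → E₁, IntEq ι μ T 0 w (fun t => -B (w t)) → ∀ t ∈ Ioc 0 T, w t = 0)
    {v : ℝ → E₁} (hv : IntEq ι μ τ 0 v (fun t => -B (v t))) : ∀ t ∈ Ioc 0 τ, v t = 0 := by
  set V : ℝ → E₁ := fun t => ∫ s in (0 : ℝ)..t, v s with hV
  have hint : ∀ t ∈ Icc 0 τ, IntervalIntegrable v MeasureTheory.volume 0 t := fun t ht =>
    hv.memBC.intervalIntegrable_of_mem hμ.1 hτ ⟨le_rfl, hτ.le⟩ ht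
  have hV0 : V 0 = 0 := intervalIntegral.integral_same
  have hVc : ContinuousOn V (Icc 0 τ) := by
    have := intervalIntegral.continuousOn_primitive_interval' (hint τ ⟨hτ.le, le_rfl⟩)
      (left_mem_uIcc)
    rwa [uIcc_of_le hτ.le] at this
  have hvV : ∀ t ∈ Ioc 0 τ, ι (v t) = -B (V t) := fun t ht => by
    rw [hv.eq t ht, zero_add, intervalIntegral.integral_neg,
      ContinuousLinearMap.intervalIntegral_comp_comm B (hint t ⟨ht.1.le, ht.2⟩)]
  set H : ℝ → E₀ := fun r => -B (V (max r 0)) with hH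
  have hιV : ∀ t ∈ Icc 0 τ, ι (V t) = ∫ r in (0 : ℝ)..t, H r := fun t ht => by
    rw [hV, ← ContinuousLinearMap.intervalIntegral_comp_comm ι (hint t ht)]
    refine intervalIntegral.integral_congr_ae (Eventually.of_forall fun s hs => ?_)
    rw [uIoc_of_le ht.1] at hs
    change ι (v s) = -B (V (max s 0))
    rw [max_eq_left hs.1.le]
    exact hvV s ⟨hs.1, hs.2.trans ht.2⟩
  have hHc : ContinuousOn H (Iic τ) :=
    (B.continuous.comp_continuousOn (hVc.comp (by fun_prop)
      fun r hr => ⟨le_max_right _ _, max_le hr hτ.le⟩)).neg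
  have hHz : ∀ r ≤ 0, H r = 0 := fun r hr => by
    simp [hH, max_eq_right hr, hV0]
  set s := T - τ with hs
  have hs0 : 0 ≤ s := by linarith
  have hW := hT (fun t => V (max (t - s) 0)) ⟨?_, ?_, ?_⟩
  · intro t ht
    have h1 := hW (t + s) ⟨by linarith [ht.1], by linarith [ht.2]⟩
    rw [add_sub_cancel_right, max_eq_left ht.1.le] at h1
    refine hinj ?_
    rw [hvV t ht, h1]
    simp
  · refine memBC_of_continuousOn_Icc hμ.2 (hτ.trans_le hτT) (hVc.comp (by fun_prop) fun r hr =>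
      ⟨le_max_right _ _, max_le (by linarith [hr.2]) hτ.le⟩)
  · refine memBC_of_continuousOn_Icc hμ.2 (hτ.trans_le hτT)
      (hHc.comp (by fun_prop) fun r hr => ?_)
    change r - s ≤ τ
    linarith [hr.2]
  · intro t ht
    rw [zero_add, intervalIntegral.integral_comp_sub_right H s]
    have hi : ∀ a b, a ≤ τ → b ≤ τ → IntervalIntegrable H MeasureTheory.volume a b :=
      fun a b ha hb => (hHc.mono fun r hr => hr.2.trans (max_le ha hb)).intervalIntegrable
    have h0 : ∀ b ≤ 0, ∫ r in (0 - s)..b, H r = 0 := fun b hb => by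
      rw [intervalIntegral.integral_congr_ae (g := fun _ => 0)
        (Eventually.of_forall fun r hr => hHz r ?_), intervalIntegral.integral_zero]
      exact hr.2.trans (max_le (by linarith) hb)
    rcases le_total (t - s) 0 with h | h
    · rw [max_eq_right h, hV0, map_zero, h0 _ h]
    · rw [max_eq_left h, hιV _ ⟨h, by linarith [ht.2]⟩,
        ← intervalIntegral.integral_add_adjacent_intervals (hi (0 - s) 0 (by linarith) hτ.le)
          (hi 0 (t - s) hτ.le (by linarith [ht.2])), h0 0 le_rfl, zero_add]

/-- A bounded solution operator of the linear problem `u' + B u = f`, `u(0) = x` on `[0,T]`,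
together with the uniqueness of solutions on the intervals `[0,τ]`, `τ ≤ T`. -/
structure SolOp (ι B : E₁ →L[ℝ] E₀) (μ : ℝ) (hμ : μ ∈ Ioo (0 : ℝ) 1) where
  T : ℝ
  pos : 0 < T
  S : wSpace T E₀ × Interp ι μ →L[ℝ] wSpace T E₁
  intEq : ∀ g x, IntEq ι μ T x.val (unw μ (S (g, x)))
    (fun t => unw μ g t - B (unw μ (S (g, x)) t))
  unique : ∀ τ, 0 < τ → τ ≤ T → ∀ v : ℝ → E₁, IntEq ι μ τ 0 v (fun t => -B (v t)) →
    ∀ t ∈ Ioc 0 τ, v t = 0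

/-- In integrated form the relation between solution and data consists of one continuous linear
equation for each time `t`. It is therefore closed, and by maximal regularity it is the graph of a
function. -/
theorem nonempty_solOp (hinj : Function.Injective ι) (hμ : μ ∈ Ioo (0 : ℝ) 1)
    (hB : B ∈ maxReg ι μ) : Nonempty (SolOp ι B μ hμ) := by
  obtain ⟨T, hT, hsol⟩ := (maxReg_iff hμ).1 hB
  let Y := wSpace T E₁
  let X := wSpace T E₀ × Interp ι μ
  -- On `(u, (f, x))`, in weighted form, `Φ t` is the defect `u(t) - x - ∫ f + B ∫ u` of the
  -- integrated equation, with the integrals over `[0,t]`.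
  let Φ : ∀ t : Ioc 0 T, Y × X →L[ℝ] E₀ := fun t =>
    (ι.comp (((t : ℝ) ^ (μ - 1)) • (BoundedContinuousFunction.evalCLM ℝ (t : ℝ)).comp
        (Submodule.subtypeL (wSpace T E₁)))).comp (ContinuousLinearMap.fst ℝ Y X) -
      ((Interp.valL ι μ).comp (ContinuousLinearMap.snd ℝ _ _)).comp
        (ContinuousLinearMap.snd ℝ Y X) -
      ((primL hμ T t.2.1).comp (ContinuousLinearMap.fst ℝ _ _)).comp
        (ContinuousLinearMap.snd ℝ Y X) +
      (B.comp (primL hμ T t.2.1)).comp (ContinuousLinearMap.fst ℝ Y X)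
  let Z : Submodule ℝ (Y × X) := ⨅ t, LinearMap.ker (Φ t : Y × X →ₗ[ℝ] E₀)
  have hZc : IsClosed (Z : Set (Y × X)) := by
    simp only [Z, Submodule.coe_iInf]
    exact isClosed_iInter fun t => (Φ t).isClosed_ker
  have hΦ : ∀ (t : Ioc 0 T) (z : Y × X), Φ t z = 0 ↔
      ι (unw μ z.1 t) = z.2.2.val +
        ∫ s in (0 : ℝ)..t, (unw μ z.2.1 s - B (unw μ z.1 s)) := fun t z => by
    have h1 := (memBC_unw hμ.2 z.1 t).intervalIntegrable hμ.1 t.2.1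
    have h2 := (memBC_unw hμ.2 z.2.1 t).intervalIntegrable hμ.1 t.2.1
    have h3 := ((memBC_unw hμ.2 z.1 t).clm hμ.2 B).intervalIntegrable hμ.1 t.2.1
    rw [intervalIntegral.integral_sub h2 h3,
      ContinuousLinearMap.intervalIntegral_comp_comm B h1]
    change ι (unw μ z.1 t) - z.2.2.val - (∫ s in (0 : ℝ)..t, unw μ z.2.1 s) +
      B (∫ s in (0 : ℝ)..t, unw μ z.1 s) = 0 ↔ _
    rw [← sub_eq_zero (b := z.2.2.val + _)]
    refine Eq.congr ?_ rfl
    abel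
  have hZ : ∀ z : Y × X, z ∈ Z ↔ IntEq ι μ T z.2.2.val (unw μ z.1)
      (fun t => unw μ z.2.1 t - B (unw μ z.1 t)) := fun z => by
    simp only [Z, Submodule.mem_iInf, LinearMap.mem_ker, ContinuousLinearMap.coe_coe, hΦ]
    exact ⟨fun h => ⟨memBC_unw hμ.2 _ _, (memBC_unw hμ.2 _ _).sub hμ.2
      ((memBC_unw hμ.2 _ _).clm hμ.2 B), fun t ht => h ⟨t, ht⟩⟩, fun h t => h.eq t t.2⟩
  have hinjW : ∀ g h : Y, EqOn (unw μ g) (unw μ h) (Ioc 0 T) → g = h := fun g h hgh => by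
    have h1 : ∀ t ∈ Ioc 0 T, g.1 t = h.1 t := fun t ht =>
      smul_right_injective E₁ (Real.rpow_pos_of_pos ht.1 (μ - 1)).ne' (hgh ht)
    refine Subtype.ext (BoundedContinuousFunction.ext fun t => ?_)
    rcases le_or_gt t 0 with h0 | h0
    · rw [g.2.1 t h0, h.2.1 t h0]
    · rcases le_or_gt t T with h2 | h2
      · exact h1 t ⟨h0, h2⟩
      · rw [g.2.2 t h2.le, h.2.2 t h2.le, h1 T ⟨hT, le_rfl⟩]
  have hZu : ∀ p q q', (q, p) ∈ Z → (q', p) ∈ Z → q = q' := fun p q q' hz hz' => by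
    obtain ⟨u, -, hu⟩ := hsol (unw μ p.1) (memBC_unw hμ.2 _ _) p.2
    exact hinjW q q' ((hu _ ((hZ _).1 hz)).trans (hu _ ((hZ _).1 hz')).symm)
  have hZs : ∀ p, ∃ q, (q, p) ∈ Z := by
    rintro ⟨g, x⟩
    obtain ⟨u, hu, -⟩ := hsol (unw μ g) (memBC_unw hμ.2 _ _) x
    have h1 := unw_toW hμ.2 hT le_rfl hu.memBC
    exact ⟨toW hμ.2 hT le_rfl u hu.memBC, (hZ _).2 (hu.congr hT h1 fun t ht => by
      simp only [h1 ht])⟩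
  obtain ⟨S, hS⟩ := exists_clm_of_isClosed_graph Z hZc hZu hZs
  refine ⟨⟨T, hT, S, fun g x => (hZ _).1 (hS (g, x)), fun τ hτ hτT v hv =>
      intEq_zero_unique hinj hμ hτ hτT (fun w hw => ?_) hv⟩⟩
  · obtain ⟨u, -, hu⟩ := hsol (fun _ => 0)
      (memBC_of_continuousOn_Icc hμ.2 hT continuousOn_const) 0
    have h0 : IntEq ι μ T (0 : Interp ι μ).val (fun _ => 0) (fun t => 0 - B 0) :=
      ⟨memBC_of_continuousOn_Icc hμ.2 hT continuousOn_const,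
        memBC_of_continuousOn_Icc hμ.2 hT continuousOn_const, fun t _ => by
          simp only [map_zero, sub_zero, intervalIntegral.integral_zero, add_zero]; rfl⟩
    exact fun t ht => (hu w (by simp only [zero_sub]; exact hw) ht).trans (hu _ h0 ht).symm

namespace SolOp

variable {hμ : μ ∈ Ioo (0 : ℝ) 1} (D : SolOp ι B μ hμ)

/-- The solution of `u' + B u = f`, `u(0) = x`, where `g` is the weighted counterpart of `f`. -/
def sol (g : wSpace D.T E₀) (x : Interp ι μ) (t : ℝ) : E₁ := unw μ (D.S (g, x)) t

theorem sol_sub (g h : wSpace D.T E₀) (x y : Interp ι μ) (t : ℝ) :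
    D.sol (g - h) (x - y) t = D.sol g x t - D.sol h y t := by
  rw [sol, sol, sol, ← unw_sub, ← map_sub]; rfl

/-- A common bound for the weighted norm in `E₁`, the weighted norm of the derivative, and the
norm in `E_μ` of the solutions of the linear problem. -/
def bound : ℝ := 1 + (2 + 1 / μ) * ((1 + ‖B‖) * ‖D.S‖ + 1)

theorem one_le_bound : 1 ≤ D.bound := by
  have := hμ.1
  have : 0 ≤ (2 + 1 / μ) * ((1 + ‖B‖) * ‖D.S‖ + 1) := by positivity
  unfold bound
  linarith

theorem weight_aux (g : wSpace D.T E₀) (x : Interp ι μ) {t : ℝ} (ht : 0 < t) :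
    t ^ (1 - μ) * ‖D.sol g x t‖ ≤ ((1 + ‖B‖) * ‖D.S‖ + 1) * (‖g‖ + ‖x‖) ∧
    t ^ (1 - μ) * ‖unw μ g t - B (D.sol g x t)‖ ≤
      ((1 + ‖B‖) * ‖D.S‖ + 1) * (‖g‖ + ‖x‖) := by
  have h1 : t ^ (1 - μ) * ‖D.sol g x t‖ ≤ ‖D.S‖ * (‖g‖ + ‖x‖) := by
    rw [sol, weight_norm_unw _ ht]
    refine (wSpace.norm_apply_le _ t).trans ((D.S.le_opNorm _).trans ?_)
    refine mul_le_mul_of_nonneg_left ?_ (norm_nonneg _)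
    exact max_le (by linarith [norm_nonneg x]) (by linarith [norm_nonneg g])
  have h2 : t ^ (1 - μ) * ‖unw μ g t‖ ≤ ‖g‖ := by
    rw [weight_norm_unw _ ht]; exact wSpace.norm_apply_le g t
  have h3 := B.le_opNorm (D.sol g x t)
  have hw : 0 ≤ t ^ (1 - μ) := Real.rpow_nonneg ht.le _
  have hs : 0 ≤ ‖g‖ + ‖x‖ := by positivity
  have hB := mul_nonneg (norm_nonneg B) (mul_nonneg (norm_nonneg D.S) hs)
  have h4 : t ^ (1 - μ) * ‖B (D.sol g x t)‖ ≤ ‖B‖ * (‖D.S‖ * (‖g‖ + ‖x‖)) :=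
    calc _ ≤ t ^ (1 - μ) * (‖B‖ * ‖D.sol g x t‖) := mul_le_mul_of_nonneg_left h3 hw
      _ = ‖B‖ * (t ^ (1 - μ) * ‖D.sol g x t‖) := by ring
      _ ≤ _ := mul_le_mul_of_nonneg_left h1 (norm_nonneg _)
  have h5 := mul_le_mul_of_nonneg_left (norm_sub_le (unw μ g t) (B (D.sol g x t))) hw
  have hx := norm_nonneg x
  have hS := mul_nonneg (norm_nonneg D.S) hs
  constructor <;> nlinarith

theorem le_bound {r : ℝ} (hr : 0 ≤ r) : ((1 + ‖B‖) * ‖D.S‖ + 1) * r ≤ D.bound * r := by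
  refine mul_le_mul_of_nonneg_right ?_ hr
  have h1 := hμ.1
  have h2 : 0 ≤ (1 + ‖B‖) * ‖D.S‖ + 1 := by positivity
  have h3 : 0 ≤ 1 / μ := by positivity
  unfold bound
  nlinarith [mul_nonneg h3 h2]

theorem weight_sol_le (g : wSpace D.T E₀) (x : Interp ι μ) {t : ℝ} (ht : 0 < t) :
    t ^ (1 - μ) * ‖D.sol g x t‖ ≤ D.bound * (‖g‖ + ‖x‖) :=
  (D.weight_aux g x ht).1.trans (D.le_bound (by positivity))

theorem weight_deriv_le (g : wSpace D.T E₀) (x : Interp ι μ) {t : ℝ} (ht : 0 < t) :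
    t ^ (1 - μ) * ‖unw μ g t - B (D.sol g x t)‖ ≤ D.bound * (‖g‖ + ‖x‖) :=
  (D.weight_aux g x ht).2.trans (D.le_bound (by positivity))

theorem norm_of_sol_le (g : wSpace D.T E₀) (x : Interp ι μ) {t : ℝ} (ht : t ∈ Ioc 0 D.T) :
    ‖Interp.of ι hμ (D.sol g x t)‖ ≤ D.bound * (‖g‖ + ‖x‖) := by
  have h := (D.intEq g x).norm_of_sub_le hμ ht (fun s hs => (D.weight_aux g x hs.1).1)
    fun s hs => (D.weight_aux g x hs.1).2
  have h1 := norm_le_insert' (Interp.of ι hμ (D.sol g x t)) x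
  change ‖Interp.of ι hμ (D.sol g x t) - x‖ ≤ _ at h
  have hg := norm_nonneg g
  unfold bound
  nlinarith

end SolOp

end Linear

/-! ### Weighted Lipschitz estimates for the nonlinearity -/

section Nonlinearity

set_option linter.unusedSectionVars false

/-- The weighted estimate behind the condition on the exponents in `(H2)`: the weight absorbs the
growth of the nonlinearity, with a gain of a positive power of `d`. -/
theorem weighted_growth_le {α γ ρ w d K n₁ n₂ N₁ N₂ a₁ a₂ a b D : ℝ} (hα : α < 1)
    (hα0 : 0 ≤ α) (hγ0 : 0 ≤ γ) (hγα : γ ≤ α) (hρ : 0 ≤ ρ) (hαγ : ρ * α + γ ≤ 1)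
    (hw : 0 < w) (hwd : w ≤ d) (hd : d ≤ 1) (hn₁ : 0 ≤ n₁) (hn₂ : 0 ≤ n₂)
    (hwn₁ : w * n₁ ≤ d) (hwn₂ : w * n₂ ≤ d) (ha₁ : 0 ≤ a₁) (ha₂ : 0 ≤ a₂) (hK₁ : a₁ ≤ K)
    (hK₂ : a₂ ≤ K) (hN₁0 : 0 ≤ N₁) (hN₂0 : 0 ≤ N₂) (hN₁ : N₁ ≤ a₁ ^ (1 - α) * n₁ ^ α)
    (hN₂ : N₂ ≤ a₂ ^ (1 - α) * n₂ ^ α) (ha : 0 ≤ a) (hb : 0 ≤ b)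
    (hD : D ≤ a ^ (1 - γ) * b ^ γ) :
    w * ((1 + N₁ ^ ρ + N₂ ^ ρ) * D) ≤
      (1 + 2 * K ^ ((1 - α) * ρ)) * d ^ (1 - α) * (a + w * b) := by
  have hd0 : 0 < d := hw.trans_le hwd
  have hK : 0 ≤ K := ha₁.trans hK₁
  have hdγ : d ^ (1 - γ) ≤ d ^ (1 - α) :=
    Real.rpow_le_rpow_of_exponent_ge hd0 hd (by linarith)
  -- The factor `w ^ (α * ρ)` of `w ^ (1 - γ)` is spent on `n ^ (α * ρ)`. The exponent `1 - γ - α *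
  -- ρ` that remains is nonnegative by `ρ * α + γ ≤ 1`; it may vanish, and then the power of `d`
  -- comes from `w * n ≤ d` alone.
  have key : ∀ {n N a' : ℝ}, 0 ≤ n → w * n ≤ d → 0 ≤ a' → a' ≤ K → 0 ≤ N →
      N ≤ a' ^ (1 - α) * n ^ α → w ^ (1 - γ) * N ^ ρ ≤ K ^ ((1 - α) * ρ) * d ^ (1 - α) := by
    intro n N a' hn hwn ha' haK hN0 hN
    have h1 : N ^ ρ ≤ K ^ ((1 - α) * ρ) * n ^ (α * ρ) := by
      rw [Real.rpow_mul hK, Real.rpow_mul hn, ← Real.mul_rpow (Real.rpow_nonneg hK _)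
        (Real.rpow_nonneg hn _)]
      refine Real.rpow_le_rpow hN0 (hN.trans (mul_le_mul_of_nonneg_right
        (Real.rpow_le_rpow ha' haK (by linarith)) (Real.rpow_nonneg hn _))) hρ
    have h2 : w ^ (1 - γ) = w ^ (1 - γ - α * ρ) * w ^ (α * ρ) := by
      rw [← Real.rpow_add hw]; congr 1; ring
    have h3 : w ^ (1 - γ) * n ^ (α * ρ) ≤ d ^ (1 - γ) := by
      rw [h2, mul_assoc, ← Real.mul_rpow hw.le hn]
      have h4 : d ^ (1 - γ) = d ^ (1 - γ - α * ρ) * d ^ (α * ρ) := by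
        rw [← Real.rpow_add hd0]; congr 1; ring
      rw [h4]
      exact mul_le_mul (Real.rpow_le_rpow hw.le hwd (by linarith [mul_comm ρ α]))
        (Real.rpow_le_rpow (by positivity) hwn (by positivity)) (by positivity) (by positivity)
    calc w ^ (1 - γ) * N ^ ρ ≤ w ^ (1 - γ) * (K ^ ((1 - α) * ρ) * n ^ (α * ρ)) :=
          mul_le_mul_of_nonneg_left h1 (by positivity)
      _ = K ^ ((1 - α) * ρ) * (w ^ (1 - γ) * n ^ (α * ρ)) := by ring
      _ ≤ K ^ ((1 - α) * ρ) * d ^ (1 - α) :=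
          mul_le_mul_of_nonneg_left (h3.trans hdγ) (by positivity)
  have hA : w ^ (1 - γ) * (1 + N₁ ^ ρ + N₂ ^ ρ) ≤
      (1 + 2 * K ^ ((1 - α) * ρ)) * d ^ (1 - α) := by
    have h1 := key hn₁ hwn₁ ha₁ hK₁ hN₁0 hN₁
    have h2 := key hn₂ hwn₂ ha₂ hK₂ hN₂0 hN₂
    have h3 : w ^ (1 - γ) ≤ d ^ (1 - α) :=
      (Real.rpow_le_rpow hw.le hwd (by linarith)).trans hdγ
    nlinarith
  -- The other part `w ^ γ` of the weight turns `b ^ γ` into `(w * b) ^ γ`.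
  have hB : w ^ γ * D ≤ a + w * b := by
    have hwb : 0 ≤ w * b := by positivity
    have hs : 0 ≤ a + w * b := by positivity
    calc w ^ γ * D ≤ w ^ γ * (a ^ (1 - γ) * b ^ γ) := mul_le_mul_of_nonneg_left hD (by positivity)
      _ = a ^ (1 - γ) * (w * b) ^ γ := by rw [Real.mul_rpow hw.le hb]; ring
      _ ≤ (a + w * b) ^ (1 - γ) * (a + w * b) ^ γ :=
          mul_le_mul (Real.rpow_le_rpow ha (by linarith) (by linarith))
            (Real.rpow_le_rpow hwb (by linarith) hγ0) (by positivity) (by positivity)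
      _ = a + w * b := by rw [← Real.rpow_add_of_nonneg hs (by linarith) hγ0]; simp
  have hsplit : w = w ^ (1 - γ) * w ^ γ := by rw [← Real.rpow_add hw]; simp
  calc w * ((1 + N₁ ^ ρ + N₂ ^ ρ) * D)
      = (w ^ (1 - γ) * (1 + N₁ ^ ρ + N₂ ^ ρ)) * (w ^ γ * D) := by
        conv_lhs => rw [hsplit]
        ring
    _ ≤ (w ^ (1 - γ) * (1 + N₁ ^ ρ + N₂ ^ ρ)) * (a + w * b) :=
        mul_le_mul_of_nonneg_left hB (by positivity)
    _ ≤ _ := mul_le_mul_of_nonneg_right hA (by positivity)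

variable {E₀ E₁ : Type*} [NormedAddCommGroup E₀] [NormedSpace ℝ E₀]
  [NormedAddCommGroup E₁] [NormedSpace ℝ E₁] {ι : E₁ →L[ℝ] E₀} {μ : ℝ}

theorem interpNorm_nonneg (θ : ℝ) (x : E₀) : 0 ≤ interpNorm ι θ x :=
  Real.iSup_nonneg fun t => mul_nonneg (Real.rpow_nonneg (le_of_lt t.2) _) (kFun_nonneg ι t.2 _)

/-- Interpolation between `E_μ` and `E₁` gives `E_β` the exponent `α = (β - μ) / (1 - μ)` and
`E_{β_j}` the exponent `γ_j = (β_j - μ) / (1 - μ)`. In these terms the condition in (H2) reads `ρ_j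
α + γ_j ≤ 1`, and `weighted_growth_le` applies to each term of the sum. -/
theorem H2.exists_weighted_bound {V : Set (Interp ι μ)} {F₂ : Interp ι μ → E₀} (hF : H2 ι V F₂)
    (hμ : μ ∈ Ioo (0 : ℝ) 1) {X : Interp ι μ} (hX : X ∈ V) :
    ∃ α < (1 : ℝ), ∃ C : ℝ, 0 ≤ C ∧ ∀ d ≤ (1 : ℝ), ∀ w, 0 < w → w ≤ d → ∀ y₁ y₂ : E₁,
      ‖Interp.of ι hμ y₁ - X‖ ≤ 1 → Interp.of ι hμ y₁ ∈ V → w * ‖y₁‖ ≤ d →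
      ‖Interp.of ι hμ y₂ - X‖ ≤ 1 → Interp.of ι hμ y₂ ∈ V → w * ‖y₂‖ ≤ d →
      w * ‖F₂ (Interp.of ι hμ y₁) - F₂ (Interp.of ι hμ y₂)‖ ≤
        C * d ^ (1 - α) * (‖Interp.of ι hμ y₁ - Interp.of ι hμ y₂‖ + w * ‖y₁ - y₂‖) := by
  obtain ⟨β, hβ, m, b, ρ, hbρ, hF⟩ := hF
  obtain ⟨C, hC, hF⟩ := hF X hX 1 one_pos
  have h1μ : 0 < 1 - μ := by linarith [hμ.2]
  set α := (β - μ) / (1 - μ) with hα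
  set K := ‖X‖ + 1 with hK
  have hK0 : 0 ≤ K := by positivity
  have hβ' : β ∈ Ioo (0 : ℝ) 1 := ⟨hμ.1.trans hβ.1, hβ.2⟩
  refine ⟨α, (div_lt_one h1μ).2 (by linarith [hβ.2]),
    C * ∑ j, (1 + 2 * K ^ ((1 - α) * ρ j)), ?_, ?_⟩
  · exact mul_nonneg hC.le (Finset.sum_nonneg fun j _ => by positivity)
  intro d hd w hw hwd y₁ y₂ h1 h1V h1w h2 h2V h2w
  have hle := hF _ ⟨mem_closedBall_iff_norm.2 h1, h1V⟩ _ ⟨mem_closedBall_iff_norm.2 h2, h2V⟩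
    (mem_interp ι hβ' y₁) (mem_interp ι hβ' y₂)
  refine (mul_le_mul_of_nonneg_left hle hw.le).trans ?_
  rw [mul_left_comm, mul_assoc, mul_assoc]
  refine mul_le_mul_of_nonneg_left ?_ hC.le
  rw [Finset.mul_sum, Finset.sum_mul]
  refine Finset.sum_le_sum fun j _ => ?_
  have hball : ∀ y : E₁, ‖Interp.of ι hμ y - X‖ ≤ 1 → ‖Interp.of ι hμ y‖ ≤ K := fun y hy => by
    linarith [norm_le_insert' (Interp.of ι hμ y) X]
  have hρα : ρ j * α + (b j - μ) / (1 - μ) ≤ 1 := by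
    have := (hbρ j).2.2
    rwa [add_div, mul_div_assoc] at this
  rw [← mul_assoc (1 + 2 * K ^ ((1 - α) * ρ j))]
  simp only [Interp.val_of, ← map_sub]
  have hβI : β ∈ Icc μ 1 := ⟨hβ.1.le, hβ.2.le⟩
  refine weighted_growth_le (γ := (b j - μ) / (1 - μ)) (α := α)
    (a := ‖Interp.of ι hμ y₁ - Interp.of ι hμ y₂‖) (b := ‖y₁ - y₂‖)
    ((div_lt_one h1μ).2 (by linarith [hβ.2])) (div_nonneg (by linarith [hβ.1]) h1μ.le)
    (div_nonneg (by linarith [(hbρ j).1.1]) h1μ.le)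
    (div_le_div_of_nonneg_right (by linarith [(hbρ j).1.2]) h1μ.le) (hbρ j).2.1 hρα hw hwd hd
    (norm_nonneg y₁) (norm_nonneg y₂) h1w h2w (norm_nonneg _) (norm_nonneg _)
    (hball _ h1) (hball _ h2) (interpNorm_nonneg _ _) (interpNorm_nonneg _ _)
    (interpNorm_le_rpow_mul_rpow hμ hβI y₁) (interpNorm_le_rpow_mul_rpow hμ hβI y₂)
    (norm_nonneg _) (norm_nonneg _) ?_
  rw [← Interp.of_sub]
  exact interpNorm_le_rpow_mul_rpow hμ ⟨(hbρ j).1.1, (hbρ j).1.2.trans hβ.2.le⟩ _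

variable (ι) in
/-- The structure of the right-hand side `N` of the autonomous equation `u' = N(u)` that is used
in its solution: near every point of `V`, `N` is the sum of a linear operator with maximal
regularity and a perturbation with an arbitrarily small Lipschitz constant in weighted norms. -/
def Admissible (hμ : μ ∈ Ioo (0 : ℝ) 1) (V : Set (Interp ι μ)) (N : E₁ → E₀) : Prop :=
  ∀ X ∈ V, ∃ B ∈ maxReg ι μ, ∀ κ > 0, ∃ d > 0, ∀ w, 0 < w → w ≤ d → ∀ y₁ y₂ : E₁,
    ‖Interp.of ι hμ y₁ - X‖ ≤ d → w * ‖y₁‖ ≤ d →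
    ‖Interp.of ι hμ y₂ - X‖ ≤ d → w * ‖y₂‖ ≤ d →
      Interp.of ι hμ y₁ ∈ V ∧ w * ‖(N y₁ + B y₁) - (N y₂ + B y₂)‖ ≤
        κ * (‖Interp.of ι hμ y₁ - Interp.of ι hμ y₂‖ + w * ‖y₁ - y₂‖)

variable (ι) in
/-- The right-hand side `F₁(u) + F₂(u) - A(u) u` of the quasilinear equation. -/
def rhs (hμ : μ ∈ Ioo (0 : ℝ) 1) (A : Interp ι μ → E₁ →L[ℝ] E₀) (F₁ F₂ : Interp ι μ → E₀)
    (y : E₁) : E₀ :=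
  F₁ (Interp.of ι hμ y) + F₂ (Interp.of ι hμ y) - A (Interp.of ι hμ y) y

theorem admissible_rhs (hμ : μ ∈ Ioo (0 : ℝ) 1) {V : Set (Interp ι μ)} (hV : IsOpen V)
    {A : Interp ι μ → E₁ →L[ℝ] E₀} {F₁ F₂ : Interp ι μ → E₀} (h1 : H1 ι V A F₁)
    (h2 : H2 ι V F₂) : Admissible ι hμ V (rhs ι hμ A F₁ F₂) := by
  intro X hX
  refine ⟨A X, h1.2 X hX, fun κ hκ => ?_⟩
  obtain ⟨L, t, ht, hL⟩ := h1.1 hX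
  rw [hV.nhdsWithin_eq hX] at ht
  obtain ⟨r, hr, hrt⟩ := Metric.nhds_basis_closedBall.mem_iff.1 (inter_mem ht (hV.mem_nhds hX))
  obtain ⟨α, hα, C, hC, hF⟩ := h2.exists_weighted_bound hμ hX
  -- This will be the Lipschitz constant: `F₁` and the two terms from `A` contribute multiples of `L
  -- * d`, and `F₂` contributes `C * d ^ (1 - α)`.
  have hlim : Tendsto (fun d : ℝ => 2 * L * d + C * d ^ (1 - α)) (𝓝[>] 0) (𝓝 0) := by
    have h3 : Tendsto (fun d : ℝ => 2 * L * d) (𝓝[>] 0) (𝓝 0) := by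
      have : Tendsto (fun d : ℝ => 2 * L * d) (𝓝 0) (𝓝 (2 * L * 0)) :=
        (continuous_const.mul continuous_id).tendsto 0
      rw [mul_zero] at this
      exact this.mono_left nhdsWithin_le_nhds
    simpa using h3.add ((tendsto_rpow_zero (show 0 < 1 - α by linarith)).const_mul C)
  obtain ⟨d, hdκ, hd⟩ := ((hlim.eventually_le_const hκ).and
    (Ioc_mem_nhdsGT_zero (show 0 < min r 1 by positivity))).exists
  have hd0 : 0 < d := hd.1
  have hdr : d ≤ r := hd.2.trans (min_le_left _ _)
  have hd1 : d ≤ 1 := hd.2.trans (min_le_right _ _)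
  refine ⟨d, hd0, fun w hw hwd y₁ y₂ hy₁ hwy₁ hy₂ hwy₂ => ?_⟩
  set x₁ := Interp.of ι hμ y₁ with hx₁
  set x₂ := Interp.of ι hμ y₂ with hx₂
  have m₁ := hrt (mem_closedBall_iff_norm.2 (hy₁.trans hdr))
  have m₂ := hrt (mem_closedBall_iff_norm.2 (hy₂.trans hdr))
  have mX := hrt (Metric.mem_closedBall_self hr.le)
  refine ⟨m₁.2, ?_⟩
  have hA : ∀ z₁ ∈ t, ∀ z₂ ∈ t, ‖A z₁ - A z₂‖ ≤ L * ‖z₁ - z₂‖ := fun z₁ hz₁ z₂ hz₂ => by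
    have := hL.dist_le_mul z₁ hz₁ z₂ hz₂
    rw [Prod.dist_eq, dist_eq_norm z₁ z₂] at this
    simpa [dist_eq_norm] using (le_max_left _ _).trans this
  have hF1 : ‖F₁ x₁ - F₁ x₂‖ ≤ L * ‖x₁ - x₂‖ := by
    have := hL.dist_le_mul x₁ m₁.1 x₂ m₂.1
    rw [Prod.dist_eq, dist_eq_norm x₁ x₂] at this
    simpa [dist_eq_norm] using (le_max_right _ _).trans this
  have hF2 := hF d hd1 w hw hwd y₁ y₂ (hy₁.trans hd1) m₁.2 hwy₁ (hy₂.trans hd1) m₂.2 hwy₂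
  rw [← hx₁, ← hx₂] at hF2
  -- In the first term with `A`, smallness comes from `w * ‖y₁‖ ≤ d`; in the second, from `A X - A
  -- x₂`, as `x₂` is within `d` of `X`.
  have hdecomp : (rhs ι hμ A F₁ F₂ y₁ + A X y₁) - (rhs ι hμ A F₁ F₂ y₂ + A X y₂) =
      (F₁ x₁ - F₁ x₂) + (F₂ x₁ - F₂ x₂) + ((A x₂ - A x₁) y₁ + (A X - A x₂) (y₁ - y₂)) := by
    simp only [rhs, ← hx₁, ← hx₂, sub_apply, map_sub]
    abel
  rw [hdecomp]
  set a := ‖x₁ - x₂‖ with ha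
  have ha0 : 0 ≤ a := norm_nonneg _
  have hL0 : (0 : ℝ) ≤ L := L.2
  have e1 : ‖(A x₂ - A x₁) y₁‖ ≤ L * a * ‖y₁‖ := by
    refine (ContinuousLinearMap.le_opNorm _ _).trans (mul_le_mul_of_nonneg_right ?_ (norm_nonneg _))
    rw [ha, norm_sub_rev x₁ x₂]
    exact hA _ m₂.1 _ m₁.1
  have e2 : ‖(A X - A x₂) (y₁ - y₂)‖ ≤ L * d * ‖y₁ - y₂‖ := by
    refine (ContinuousLinearMap.le_opNorm _ _).trans (mul_le_mul_of_nonneg_right ?_ (norm_nonneg _))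
    refine (hA _ mX.1 _ m₂.1).trans (mul_le_mul_of_nonneg_left ?_ hL0)
    rwa [norm_sub_rev]
  have e3 := (norm_add_le (F₁ x₁ - F₁ x₂ + (F₂ x₁ - F₂ x₂))
    ((A x₂ - A x₁) y₁ + (A X - A x₂) (y₁ - y₂))).trans
      (add_le_add (norm_add_le _ _) (norm_add_le _ _))
  set b := w * ‖y₁ - y₂‖ with hb
  have hb0 : 0 ≤ b := by positivity
  have e4 : w * (L * a * ‖y₁‖) ≤ L * a * d := by
    rw [mul_left_comm]
    exact mul_le_mul_of_nonneg_left hwy₁ (by positivity)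
  have e5 : w * (L * d * ‖y₁ - y₂‖) = L * d * b := by rw [hb]; ring
  have e6 : w * (L * a) ≤ d * (L * a) := mul_le_mul_of_nonneg_right hwd (by positivity)
  have e7 : w * ‖F₁ x₁ - F₁ x₂‖ ≤ w * (L * a) := mul_le_mul_of_nonneg_left hF1 hw.le
  have e8 := mul_le_mul_of_nonneg_left e1 hw.le
  have e9 := mul_le_mul_of_nonneg_left e2 hw.le
  have e10 := mul_le_mul_of_nonneg_left e3 hw.le
  have e11 : 0 ≤ L * d * b := by positivity
  have e12 := mul_le_mul_of_nonneg_right hdκ (add_nonneg ha0 hb0)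
  nlinarith

variable {V : Set (Interp ι μ)} {N : E₁ → E₀} {hμ : μ ∈ Ioo (0 : ℝ) 1}

/-- The estimate of `Admissible` at the point `y` itself holds for a fixed weight `w`, chosen so
small that the whole unit ball of `E₁` about `y` satisfies `w * ‖z‖ ≤ d`. Dividing by `w` gives
Lipschitz continuity near `y`. -/
theorem Admissible.continuousAt (hN : Admissible ι hμ V N) {y : E₁}
    (hy : Interp.of ι hμ y ∈ V) : ContinuousAt N y := by
  obtain ⟨B, -, hB⟩ := hN _ hy
  obtain ⟨d, hd, hest⟩ := hB 1 one_pos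
  set w := min d (d / (‖y‖ + 1)) with hw
  have hy1 : 0 < ‖y‖ + 1 := by positivity
  have hw0 : 0 < w := by positivity
  have hwy : ∀ z : E₁, ‖z‖ ≤ ‖y‖ + 1 → w * ‖z‖ ≤ d := fun z hz =>
    calc w * ‖z‖ ≤ d / (‖y‖ + 1) * (‖y‖ + 1) :=
          mul_le_mul (min_le_right _ _) hz (norm_nonneg _) (by positivity)
      _ = d := div_mul_cancel₀ _ hy1.ne'
  have hof : Tendsto (fun z => ‖Interp.of ι hμ z - Interp.of ι hμ y‖) (𝓝 y) (𝓝 0) :=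
    tendsto_iff_norm_sub_tendsto_zero.1 ((Interp.ofL ι hμ).continuous.tendsto y)
  have hsub : Tendsto (fun z => ‖z - y‖) (𝓝 y) (𝓝 0) :=
    tendsto_iff_norm_sub_tendsto_zero.1 tendsto_id
  have hG : ContinuousAt (fun z => N z + B z) y := by
    have hlim : Tendsto (fun z => w⁻¹ * (‖Interp.of ι hμ z - Interp.of ι hμ y‖ + w * ‖z - y‖))
        (𝓝 y) (𝓝 0) := by
      simpa using (hof.add (hsub.const_mul w)).const_mul w⁻¹
    refine tendsto_iff_norm_sub_tendsto_zero.2 (squeeze_zero' (Eventually.of_forall fun _ =>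
      norm_nonneg _) ?_ hlim)
    filter_upwards [hof.eventually_le_const hd, hsub.eventually_le_const one_pos] with z hz hz1
    have h := (hest w hw0 (min_le_left _ _) z y hz
      (hwy z (by linarith [norm_le_insert' z y])) (by simpa using hd.le)
      (hwy y (by linarith))).2
    rwa [one_mul, ← le_inv_mul_iff₀ hw0] at h
  have h := hG.sub (B.continuous.continuousAt (x := y))
  exact h.congr (Eventually.of_forall fun z => by simp)

/-- Decay at `0` is obtained by comparing `u t` with a fixed value `u t₀`: the weighted difference
of the images is bounded by the small quantities, and the weight times the fixed image of `u t₀`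
tends to `0`. The limit `X` cannot serve for the comparison, as it need not lie in `E₁`. -/
theorem Admissible.memBC (hN : Admissible ι hμ V N) {T : ℝ} (hT : 0 < T) {u : ℝ → E₁}
    {X : Interp ι μ} (hX : X ∈ V) (hu : MemBC μ T u)
    (hlim : Tendsto (fun t => Interp.of ι hμ (u t)) (𝓝[>] 0) (𝓝 X))
    (huV : ∀ t ∈ Ioc 0 T, Interp.of ι hμ (u t) ∈ V) : MemBC μ T (fun t => N (u t)) := by
  have hcont : ContinuousOn (fun t => N (u t)) (Ioc 0 T) := fun t ht =>
    ContinuousAt.comp_continuousWithinAt (hN.continuousAt (huV t ht)) (hu.1 t ht)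
  obtain ⟨B, -, hB⟩ := hN X hX
  obtain ⟨d₁, hd₁, hest⟩ := hB 1 one_pos
  have hwlim := tendsto_rpow_zero (show 0 < 1 - μ by linarith [hμ.2])
  have hG : MemBC μ T (fun t => N (u t) + B (u t)) := by
    refine memBC_of_tendsto hμ.2 (hcont.add (B.continuous.comp_continuousOn hu.1)) ?_
    rw [Metric.tendsto_nhds]
    intro ε hε
    set d := min d₁ (ε / 16) with hd
    have hd0 : 0 < d := by positivity
    have hdd : d ≤ d₁ := min_le_left _ _
    have hdε : d ≤ ε / 16 := min_le_right _ _
    have hev : ∀ᶠ t in 𝓝[>] (0 : ℝ), t ∈ Ioc 0 T ∧ t ^ (1 - μ) ≤ d ∧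
        t ^ (1 - μ) * ‖u t‖ ≤ d ∧ ‖Interp.of ι hμ (u t) - X‖ ≤ d :=
      Eventually.and (Ioc_mem_nhdsGT_zero hT) (((hwlim.eventually_le_const hd0)).and
        ((hu.2.2.eventually_le_const hd0).and
          ((tendsto_iff_norm_sub_tendsto_zero.1 hlim).eventually_le_const hd0)))
    obtain ⟨t₀, -, -, -, ht₀⟩ := hev.exists
    have h1 := (hwlim.mul_const ‖u t₀‖)
    have h2 := (hwlim.mul_const ‖N (u t₀) + B (u t₀)‖)
    rw [zero_mul] at h1 h2
    filter_upwards [hev, h1.eventually_le_const hd0,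
      h2.eventually_le_const (show 0 < ε / 2 by positivity)] with t ht h1t h2t
    obtain ⟨htT, htw, htu, htX⟩ := ht
    have hw0 : 0 < t ^ (1 - μ) := Real.rpow_pos_of_pos htT.1 _
    have h3 := (hest _ hw0 (htw.trans hdd) (u t) (u t₀) (htX.trans hdd) (htu.trans hdd)
      (ht₀.trans hdd) (h1t.trans hdd)).2
    have h4 : ‖Interp.of ι hμ (u t) - Interp.of ι hμ (u t₀)‖ ≤ 2 * d := by
      have := norm_sub_le_norm_sub_add_norm_sub (Interp.of ι hμ (u t)) X (Interp.of ι hμ (u t₀))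
      rw [norm_sub_rev X] at this
      linarith
    have h5 : t ^ (1 - μ) * ‖u t - u t₀‖ ≤ 2 * d := by
      have := mul_le_mul_of_nonneg_left (norm_sub_le (u t) (u t₀)) hw0.le
      linarith
    have h6 := mul_le_mul_of_nonneg_left
      (norm_le_insert' (N (u t) + B (u t)) (N (u t₀) + B (u t₀))) hw0.le
    rw [Real.dist_eq, sub_zero, abs_of_nonneg (by positivity)]
    linarith
  exact (hG.sub hμ.2 (hu.clm hμ.2 B)).congr hT fun t _ => by simp

end Nonlinearity

/-! ### Uniqueness and local existence for the nonlinear equation -/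

section Solutions

set_option linter.unusedSectionVars false

variable {E₀ E₁ : Type*} [NormedAddCommGroup E₀] [NormedSpace ℝ E₀]
  [NormedAddCommGroup E₁] [NormedSpace ℝ E₁] {ι : E₁ →L[ℝ] E₀} {μ : ℝ}
  {hμ : μ ∈ Ioo (0 : ℝ) 1} {V : Set (Interp ι μ)} {N : E₁ → E₀} {X : Interp ι μ} {T τ : ℝ}
  {u v : ℝ → E₁}

variable (ι) in
/-- `u` is a `V`-valued solution of `u' = N(u)`, `u(0) = X` on `[0,T]`, in integrated form. -/
structure Sol (hμ : μ ∈ Ioo (0 : ℝ) 1) (V : Set (Interp ι μ)) (N : E₁ → E₀) (X : Interp ι μ)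
    (T : ℝ) (u : ℝ → E₁) : Prop where
  intEq : IntEq ι μ T X.val u (fun t => N (u t))
  mem : ∀ t ∈ Ioc 0 T, Interp.of ι hμ (u t) ∈ V

theorem Sol.mono (h : Sol ι hμ V N X T u) (hτ : τ ≤ T) : Sol ι hμ V N X τ u :=
  ⟨h.intEq.mono hτ, fun t ht => h.mem t ⟨ht.1, ht.2.trans hτ⟩⟩

theorem Sol.congr (h : Sol ι hμ V N X T u) (hT : 0 < T) (hv : EqOn v u (Ioc 0 T)) :
    Sol ι hμ V N X T v :=
  ⟨h.intEq.congr hT hv fun t ht => by simp only [hv ht], fun t ht => by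
    rw [hv ht]; exact h.mem t ht⟩

theorem Sol.shift (h : Sol ι hμ V N X T u) {a : ℝ} (ha : 0 < a) (haT : a < T) :
    Sol ι hμ V N (Interp.of ι hμ (u a)) (T - a) (fun t => u (a + t)) :=
  ⟨h.intEq.shift hμ ha haT, fun t ht =>
    h.mem (a + t) ⟨by linarith [ht.1], by linarith [ht.2]⟩⟩

theorem Sol.glue (h : Sol ι hμ V N X T u) {a : ℝ} (ha : 0 < a) (haT : a < T)
    (h' : Sol ι hμ V N (Interp.of ι hμ (u a)) τ v)
    (hv : EqOn v (fun s => u (a + s)) (Ioc 0 (T - a))) :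
    Sol ι hμ V N X (a + τ) (glue a T u v) := by
  have hN : (fun t => N (QuasiPar.glue a T u v t)) =
      QuasiPar.glue a T (fun t => N (u t)) (fun t => N (v t)) := by
    ext t
    unfold QuasiPar.glue
    split_ifs <;> rfl
  refine ⟨?_, fun t ht => ?_⟩
  · rw [hN]
    exact h.intEq.glue hμ h'.intEq ha haT hv fun t ht => by simp only [hv ht]
  · rcases le_or_gt t T with htT | htT
    · rw [glue_of_le _ _ htT]
      exact h.mem t ⟨ht.1, htT⟩
    · rw [glue_of_gt hv (haT.trans htT)]
      exact h'.mem _ ⟨by linarith, by linarith [ht.2]⟩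

theorem exists_Ioc_forall_of_eventually {p : ℝ → Prop} (h : ∀ᶠ t in 𝓝[>] (0 : ℝ), p t) :
    ∃ τ > 0, ∀ t ∈ Ioc 0 τ, p t := by
  obtain ⟨τ, hτ, hs⟩ := mem_nhdsGT_iff_exists_Ioc_subset.1 h
  exact ⟨τ, hτ, hs⟩

variable [CompleteSpace E₀] [CompleteSpace E₁]

theorem Sol.memBC_add {B : E₁ →L[ℝ] E₀} (h : Sol ι hμ V N X T u) :
    MemBC μ T (fun t => N (u t) + B (u t)) :=
  h.intEq.memBC_deriv.add hμ.2 (h.intEq.memBC.clm hμ.2 B)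

/-- Solutions of the nonlinear equation, represented by the linear solution operator. -/
theorem Sol.eqOn_sol {B : E₁ →L[ℝ] E₀} (D : SolOp ι B μ hμ) (hτ : 0 < τ) (hτT : τ ≤ D.T)
    (h : Sol ι hμ V N X τ u) :
    EqOn u (D.sol (toW hμ.2 hτ hτT _ (h.memBC_add (B := B))) X) (Ioc 0 τ) := by
  set g := toW hμ.2 hτ hτT _ (h.memBC_add (B := B)) with hg
  have h1 := h.intEq.sub hμ ((D.intEq g X).mono hτT)
  rw [sub_self] at h1
  have h2 := D.unique τ hτ hτT (fun t => u t - D.sol g X t)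
    (h1.congr hτ (fun t _ => rfl) fun t ht => by
      simp only [hg, unw_toW hμ.2 hτ hτT (h.memBC_add (B := B)) ht, map_sub]
      change _ = N (u t) - (N (u t) + B (u t) - B (D.sol g X t))
      abel)
  exact fun t ht => sub_eq_zero.1 (h2 t ht)

/-- For short times both solutions lie in the region where the estimate holds. Their difference is
the linear solution with initial value `0` and right-hand side `gu - gv`. The Lipschitz constant `1
/ (4 * D.bound)`, applied to the two norms bounded by `D.bound`, gives `‖gu - gv‖ ≤ ‖gu - gv‖ / 2`.
-/
theorem Sol.exists_eqOn (hinj : Function.Injective ι) (hN : Admissible ι hμ V N) (hX : X ∈ V)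
    (hT : 0 < T) (hu : Sol ι hμ V N X T u) (hv : Sol ι hμ V N X T v) :
    ∃ τ > 0, EqOn u v (Ioc 0 τ) := by
  obtain ⟨B, hB, hest⟩ := hN X hX
  obtain ⟨D⟩ := nonempty_solOp hinj hμ hB
  have hM := D.one_le_bound
  obtain ⟨d, hd, hest⟩ := hest (1 / (4 * D.bound)) (by positivity)
  have hev : ∀ w, Sol ι hμ V N X T w → ∀ᶠ t in 𝓝[>] (0 : ℝ),
      t ^ (1 - μ) * ‖w t‖ ≤ d ∧ ‖Interp.of ι hμ (w t) - X‖ ≤ d := fun w hw =>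
    (hw.intEq.memBC.2.2.eventually_le_const hd).and
      ((tendsto_iff_norm_sub_tendsto_zero.1 (hw.intEq.tendsto_of hμ hT)).eventually_le_const hd)
  obtain ⟨τ₀, hτ₀, hall⟩ := exists_Ioc_forall_of_eventually
    (((tendsto_rpow_zero (show 0 < 1 - μ by linarith [hμ.2])).eventually_le_const hd).and
      ((hev u hu).and (hev v hv)))
  set τ := min τ₀ (min T D.T) with hτdef
  have hτ : 0 < τ := lt_min hτ₀ (lt_min hT D.pos)
  have hτT : τ ≤ T := (min_le_right _ _).trans (min_le_left _ _)
  have hτD : τ ≤ D.T := (min_le_right _ _).trans (min_le_right _ _)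
  have hu' := hu.mono hτT
  have hv' := hv.mono hτT
  have eu := hu'.eqOn_sol D hτ hτD
  have ev := hv'.eqOn_sol D hτ hτD
  set gu := toW hμ.2 hτ hτD _ (hu'.memBC_add (B := B))
  set gv := toW hμ.2 hτ hτD _ (hv'.memBC_add (B := B))
  have hsub : ∀ t ∈ Ioc 0 τ, u t - v t = D.sol (gu - gv) 0 t := fun t ht => by
    rw [eu ht, ev ht, ← D.sol_sub, sub_self]
  have hg : ‖gu - gv‖ ≤ ‖gu - gv‖ / 2 := by
    refine norm_toW_sub_le hμ.2 hτ hτD _ _ (by positivity) fun t ht => ?_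
    obtain ⟨hw, ⟨h1, h2⟩, h3, h4⟩ := hall t ⟨ht.1, ht.2.trans (min_le_left _ _)⟩
    have h5 := (hest _ (Real.rpow_pos_of_pos ht.1 _) hw (u t) (v t) h2 h1 h4 h3).2
    rw [← Interp.of_sub, hsub t ht] at h5
    have h6 := D.norm_of_sol_le (gu - gv) 0 ⟨ht.1, ht.2.trans hτD⟩
    have h7 := D.weight_sol_le (gu - gv) 0 ht.1
    rw [norm_zero, add_zero] at h6 h7
    refine h5.trans ?_
    calc 1 / (4 * D.bound) * (‖Interp.of ι hμ (D.sol (gu - gv) 0 t)‖ +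
          t ^ (1 - μ) * ‖D.sol (gu - gv) 0 t‖)
        ≤ 1 / (4 * D.bound) * (D.bound * ‖gu - gv‖ + D.bound * ‖gu - gv‖) :=
          mul_le_mul_of_nonneg_left (add_le_add h6 h7) (by positivity)
      _ = ‖gu - gv‖ / 2 := by field_simp; ring
  have hg0 : gu - gv = 0 := norm_le_zero_iff.1 (by linarith)
  refine ⟨τ, hτ, fun t ht => sub_eq_zero.1 ?_⟩
  rw [hsub t ht, hg0]
  have h7 := D.weight_sol_le 0 0 ht.1
  rw [norm_zero, norm_zero, add_zero, mul_zero] at h7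
  have h8 : 0 < t ^ (1 - μ) := Real.rpow_pos_of_pos ht.1 _
  exact norm_le_zero_iff.1 (nonpos_of_mul_nonpos_right h7 h8)

/-- Uniqueness of solutions. -/
theorem Sol.eqOn (hinj : Function.Injective ι) (hN : Admissible ι hμ V N) (hX : X ∈ V)
    (hu : Sol ι hμ V N X T u) (hv : Sol ι hμ V N X T v) : EqOn u v (Ioc 0 T) := by
  rcases le_or_gt T 0 with hT | hT
  · rw [Ioc_eq_empty (not_lt.2 hT)]; exact eqOn_empty _ _
  obtain ⟨τ, hτ, h⟩ := hu.exists_eqOn hinj hN hX hT hv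
  intro t ht
  rcases le_or_gt t τ with htτ | htτ
  · exact h ⟨ht.1, htτ⟩
  have hsub : Icc τ T ⊆ Ioc 0 T := fun s hs => ⟨hτ.trans_le hs.1, hs.2⟩
  have hcl : IsClosed ({s | u s = v s} ∩ Icc τ T) := by
    have := ((hu.intEq.memBC.1.mono hsub).sub
      (hv.intEq.memBC.1.mono hsub)).preimage_isClosed_of_isClosed isClosed_Icc
        (isClosed_singleton (x := (0 : E₁)))
    rw [inter_comm] at this
    convert this using 2
    ext s
    simp [sub_eq_zero]
  -- The set of agreement is closed and extends to the right of each of its points `s < T`, because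
  -- there both solutions restart from the same element of `V`.
  refine hcl.Icc_subset_of_forall_exists_gt (h ⟨hτ, le_rfl⟩) (fun s hs y hy => ?_) ⟨htτ.le, ht.2⟩
  obtain ⟨hsuv, hs1, hs2⟩ := hs
  change u s = v s at hsuv
  have hs0 : 0 < s := hτ.trans_le hs1
  have hv' := hv.shift hs0 hs2
  rw [← hsuv] at hv'
  obtain ⟨e, he, heq⟩ := (hu.shift hs0 hs2).exists_eqOn hinj hN (hu.mem s ⟨hs0, hs2.le⟩)
    (sub_pos.2 hs2) hv'
  have hy' : 0 < y - s := sub_pos.2 hy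
  set q := min e (y - s) with hq
  have hq0 : 0 < q := lt_min he hy'
  have hqy : q ≤ y - s := min_le_right _ _
  exact ⟨s + q, heq ⟨hq0, min_le_left _ _⟩, by linarith, by linarith⟩

/-- Local existence and Lipschitz dependence on the initial value. -/
theorem Admissible.exists_sol (hinj : Function.Injective ι) (hV : IsOpen V)
    (hN : Admissible ι hμ V N) (hX : X ∈ V) :
    ∃ τ > 0, ∃ ε > 0, ∃ σ > 0, ∃ u : Interp ι μ → ℝ → E₁,
      (∀ x, ‖x - X‖ ≤ ε → x ∈ V ∧ Sol ι hμ V N x τ (u x)) ∧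
      ∀ x₁, ‖x₁ - X‖ ≤ ε → ∀ x₂, ‖x₂ - X‖ ≤ ε → ∀ t ∈ Ioc 0 τ,
        t ^ (1 - μ) * (‖N (u x₁ t) - N (u x₂ t)‖ + ‖u x₁ t - u x₂ t‖) ≤ σ * ‖x₁ - x₂‖ := by
  obtain ⟨B, hB, hest⟩ := hN X hX
  obtain ⟨D⟩ := nonempty_solOp hinj hμ hB
  obtain ⟨M, hMdef⟩ : ∃ M, M = D.bound := ⟨_, rfl⟩
  have hM : 1 ≤ M := hMdef ▸ D.one_le_bound
  obtain ⟨d, hd, hest⟩ := hest (1 / (64 * M)) (by positivity)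
  -- With `‖g‖ ≤ r` and `‖x - X‖ ≤ r`, the linear solution differs from the one with data `(0, X)`
  -- by at most `2 * M * r = d / 2`; the latter will be held within `d / 4` by the choice of `τ₀`.
  set r := d / (4 * M) with hr
  have hr0 : 0 < r := by positivity
  have hMr : M * r = d / 4 := by rw [hr]; field_simp
  obtain ⟨rV, hrV, hball⟩ := Metric.nhds_basis_closedBall.mem_iff.1 (hV.mem_nhds hX)
  set ε := min r rV with hε
  have hε0 : 0 < ε := lt_min hr0 hrV
  have hεr : ε ≤ r := min_le_left _ _
  have hxV : ∀ x, ‖x - X‖ ≤ ε → x ∈ V := fun x hx =>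
    hball (mem_closedBall_iff_norm.2 (hx.trans (min_le_right _ _)))
  have hwlim := tendsto_rpow_zero (show 0 < 1 - μ by linarith [hμ.2])
  have hstar := D.intEq 0 X
  change IntEq ι μ D.T X.val (D.sol 0 X) _ at hstar
  obtain ⟨τ₀, hτ₀, hall₀⟩ := exists_Ioc_forall_of_eventually
    (Eventually.and (Ioc_mem_nhdsGT_zero D.pos) ((hwlim.eventually_le_const hd).and
      ((hstar.memBC.2.2.eventually_le_const (show 0 < d / 4 by positivity)).and
      ((tendsto_iff_norm_sub_tendsto_zero.1 (hstar.tendsto_of hμ D.pos)).eventually_le_const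
        (show 0 < d / 4 by positivity)))))
  -- A fixed element of `E₁` close to `X` in `E_μ`, at which `N` can be evaluated. For small `t` the
  -- weight makes its contribution negligible.
  obtain ⟨y₀, hy₀⟩ : ∃ y₀, y₀ = D.sol 0 X τ₀ := ⟨_, rfl⟩
  have hy₀X : ‖Interp.of ι hμ y₀ - X‖ ≤ d / 4 := by
    rw [hy₀]; exact (hall₀ τ₀ ⟨hτ₀, le_rfl⟩).2.2.2
  have hl1 := hwlim.mul_const ‖y₀‖
  have hl2 := hwlim.mul_const ‖N y₀ + B y₀‖
  rw [zero_mul] at hl1 hl2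
  obtain ⟨τ₁, hτ₁, hall₁⟩ := exists_Ioc_forall_of_eventually
    ((hl1.eventually_le_const hd).and
      (hl2.eventually_le_const (show 0 < r / 2 by positivity)))
  set τ := min τ₀ τ₁ with hτdef
  have hτ : 0 < τ := lt_min hτ₀ hτ₁
  have hτD : τ ≤ D.T := (min_le_left _ _).trans (hall₀ τ₀ ⟨hτ₀, le_rfl⟩).1.2
  have hall : ∀ t ∈ Ioc 0 τ, (0 < t ^ (1 - μ) ∧ t ^ (1 - μ) ≤ d) ∧
      t ^ (1 - μ) * ‖D.sol 0 X t‖ ≤ d / 4 ∧ ‖Interp.of ι hμ (D.sol 0 X t) - X‖ ≤ d / 4 ∧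
      t ^ (1 - μ) * ‖y₀‖ ≤ d ∧ t ^ (1 - μ) * ‖N y₀ + B y₀‖ ≤ r / 2 := fun t ht => by
    have h0 := hall₀ t ⟨ht.1, ht.2.trans (min_le_left _ _)⟩
    have h1 := hall₁ t ⟨ht.1, ht.2.trans (min_le_right _ _)⟩
    exact ⟨⟨Real.rpow_pos_of_pos ht.1 _, h0.2.1⟩, h0.2.2.1, h0.2.2.2, h1.1, h1.2⟩
  -- the linear solutions with data in the balls stay in the region where the estimate holds
  have hreg : ∀ g : wSpace D.T E₀, ‖g‖ ≤ r → ∀ x, ‖x - X‖ ≤ ε → ∀ t ∈ Ioc 0 τ,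
      t ^ (1 - μ) * ‖D.sol g x t‖ ≤ d ∧ ‖Interp.of ι hμ (D.sol g x t) - X‖ ≤ d := by
    intro g hg x hx t ht
    obtain ⟨⟨hw0, hw⟩, h1, h2, -, -⟩ := hall t ht
    have h3 : D.sol g x t - D.sol 0 X t = D.sol g (x - X) t := by rw [← D.sol_sub, sub_zero]
    have h4 := D.weight_sol_le g (x - X) ht.1
    have h5 := D.norm_of_sol_le g (x - X) ⟨ht.1, ht.2.trans hτD⟩
    have h6 : D.bound * (‖g‖ + ‖x - X‖) ≤ d / 2 := by
      rw [← hMdef]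
      have : M * (‖g‖ + ‖x - X‖) ≤ M * (r + r) :=
        mul_le_mul_of_nonneg_left (by linarith) (by linarith)
      linarith
    rw [← h3] at h4 h5
    rw [Interp.of_sub] at h5
    constructor
    · have h7 := mul_le_mul_of_nonneg_left (norm_le_insert' (D.sol g x t) (D.sol 0 X t)) hw0.le
      linarith
    · have h7 := norm_sub_le_norm_sub_add_norm_sub (Interp.of ι hμ (D.sol g x t))
        (Interp.of ι hμ (D.sol 0 X t)) X
      linarith
  have hmemV : ∀ g : wSpace D.T E₀, ‖g‖ ≤ r → ∀ x, ‖x - X‖ ≤ ε → ∀ t ∈ Ioc 0 τ,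
      Interp.of ι hμ (D.sol g x t) ∈ V := fun g hg x hx t ht => by
    obtain ⟨h1, h2⟩ := hreg g hg x hx t ht
    exact (hest _ (hall t ht).1.1 (hall t ht).1.2 _ _ h2 h1 h2 h1).1
  have hBC : ∀ g : wSpace D.T E₀, ‖g‖ ≤ r → ∀ x, ‖x - X‖ ≤ ε →
      MemBC μ τ (fun t => N (D.sol g x t) + B (D.sol g x t)) := fun g hg x hx => by
    have h1 := (D.intEq g x).mono hτD
    exact (hN.memBC hτ (hxV x hx) h1.memBC (h1.tendsto_of hμ hτ) (hmemV g hg x hx)).add hμ.2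
      (h1.memBC.clm hμ.2 B)
  have hlip : ∀ g : wSpace D.T E₀, ‖g‖ ≤ r → ∀ x, ‖x - X‖ ≤ ε →
      ∀ h : wSpace D.T E₀, ‖h‖ ≤ r → ∀ y, ‖y - X‖ ≤ ε → ∀ t ∈ Ioc 0 τ,
      t ^ (1 - μ) * ‖(N (D.sol g x t) + B (D.sol g x t)) - (N (D.sol h y t) + B (D.sol h y t))‖ ≤
        (‖g - h‖ + ‖x - y‖) / 32 := by
    intro g hg x hx h hh y hy t ht
    obtain ⟨h1, h2⟩ := hreg g hg x hx t ht
    obtain ⟨h3, h4⟩ := hreg h hh y hy t ht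
    refine (hest _ (hall t ht).1.1 (hall t ht).1.2 _ _ h2 h1 h4 h3).2.trans ?_
    rw [← Interp.of_sub, ← D.sol_sub]
    have h5 := D.weight_sol_le (g - h) (x - y) ht.1
    have h6 := D.norm_of_sol_le (g - h) (x - y) ⟨ht.1, ht.2.trans hτD⟩
    rw [← hMdef] at h5 h6
    refine (mul_le_mul_of_nonneg_left (add_le_add h6 h5) (by positivity)).trans (le_of_eq ?_)
    field_simp
    ring
  -- The constant `1 / (64 * M)` gives at most `4 * d / (64 * M) = r / 4` for the distance from the
  -- value at `y₀`, and that value contributes at most `r / 2`.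
  have hself : ∀ g (hg : ‖g‖ ≤ r) x (hx : ‖x - X‖ ≤ ε),
      ‖toW hμ.2 hτ hτD _ (hBC g hg x hx)‖ ≤ r := by
    intro g hg x hx
    refine norm_toW_le hμ.2 hτ hτD _ hr0.le fun t ht => ?_
    obtain ⟨⟨hw0, hw⟩, -, -, h1, h2⟩ := hall t ht
    obtain ⟨h3, h4⟩ := hreg g hg x hx t ht
    have h5 := (hest _ hw0 hw _ y₀ h4 h3 (by linarith) h1).2
    have h6 : ‖Interp.of ι hμ (D.sol g x t) - Interp.of ι hμ y₀‖ ≤ 2 * d := by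
      have := norm_sub_le_norm_sub_add_norm_sub (Interp.of ι hμ (D.sol g x t)) X
        (Interp.of ι hμ y₀)
      rw [norm_sub_rev X] at this
      linarith
    have h7 : t ^ (1 - μ) * ‖D.sol g x t - y₀‖ ≤ 2 * d := by
      have := mul_le_mul_of_nonneg_left (norm_sub_le (D.sol g x t) y₀) hw0.le
      linarith
    have h8 : 1 / (64 * M) * (‖Interp.of ι hμ (D.sol g x t) - Interp.of ι hμ y₀‖ +
        t ^ (1 - μ) * ‖D.sol g x t - y₀‖) ≤ r / 4 :=
      (mul_le_mul_of_nonneg_left (add_le_add h6 h7) (by positivity)).trans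
        (le_of_eq (by rw [hr]; field_simp; ring))
    have h9 := mul_le_mul_of_nonneg_left
      (norm_le_insert' (N (D.sol g x t) + B (D.sol g x t)) (N y₀ + B y₀)) hw0.le
    linarith
  -- The unknown of the fixed point problem is the right-hand side `g = N(u) + B u`, where `u` is
  -- the linear solution with data `(g, x)`. So the initial condition holds automatically.
  have hfix : ∀ x, ‖x - X‖ ≤ ε → ∃ g, ∃ hg : ‖g‖ ≤ r,
      ∃ hb : MemBC μ τ (fun t => N (D.sol g x t) + B (D.sol g x t)),
        toW hμ.2 hτ hτD _ hb = g := by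
    intro x hx
    let S := Metric.closedBall (0 : wSpace D.T E₀) r
    have hS : ∀ g : S, ‖g.1‖ ≤ r := fun g => mem_closedBall_zero_iff.1 g.2
    let Ψ : S → S := fun g => ⟨toW hμ.2 hτ hτD _ (hBC g (hS g) x hx),
      mem_closedBall_zero_iff.2 (hself g (hS g) x hx)⟩
    have hΨ : ContractingWith (1 / 2) Ψ := by
      refine ⟨by norm_num, LipschitzWith.of_dist_le_mul fun g h => ?_⟩
      change dist (Ψ g).1 (Ψ h).1 ≤ _ * dist g.1 h.1
      rw [dist_eq_norm, dist_eq_norm]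
      refine norm_toW_sub_le hμ.2 hτ hτD _ _ (by positivity) fun t ht => ?_
      have := hlip g (hS g) x hx h (hS h) x hx t ht
      rw [sub_self, norm_zero, add_zero] at this
      refine this.trans ?_
      have h0 := norm_nonneg (g.1 - h.1)
      simp only [NNReal.coe_div, NNReal.coe_one, NNReal.coe_ofNat]
      linarith
    have : CompleteSpace S := Metric.isClosed_closedBall.completeSpace_coe
    have : Nonempty S := ⟨⟨0, Metric.mem_closedBall_self hr0.le⟩⟩
    have h1 := hΨ.fixedPoint_isFixedPt
    exact ⟨(hΨ.fixedPoint Ψ).1, hS _, hBC _ (hS _) x hx, congrArg Subtype.val h1⟩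
  choose! G hG hb hGfix using hfix
  have hunw : ∀ x, ‖x - X‖ ≤ ε → ∀ t ∈ Ioc 0 τ,
      N (D.sol (G x) x t) = unw μ (G x) t - B (D.sol (G x) x t) := fun x hx t ht => by
    have := unw_toW hμ.2 hτ hτD (hb x hx) ht
    rw [hGfix x hx] at this
    rw [this, add_sub_cancel_right]
  refine ⟨τ, hτ, ε, hε0, 4 * M, by positivity, fun x => D.sol (G x) x,
    fun x hx => ⟨hxV x hx, ((D.intEq (G x) x).mono hτD).congr hτ (fun _ _ => rfl) (hunw x hx),
      hmemV (G x) (hG x hx) x hx⟩, fun x₁ h₁ x₂ h₂ t ht => ?_⟩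
  -- Absorbing the first term shows that the fixed points depend on `x` with Lipschitz constant at
  -- most `1`. Each of the two weighted norms is then at most `2 * M * ‖x₁ - x₂‖`, whence `σ = 4 *
  -- M`.
  have hGG : ‖G x₁ - G x₂‖ ≤ (‖G x₁ - G x₂‖ + ‖x₁ - x₂‖) / 32 := by
    conv_lhs => rw [← hGfix x₁ h₁, ← hGfix x₂ h₂]
    exact norm_toW_sub_le hμ.2 hτ hτD _ _ (by positivity)
      (hlip _ (hG x₁ h₁) x₁ h₁ _ (hG x₂ h₂) x₂ h₂)
  have hGx : ‖G x₁ - G x₂‖ ≤ ‖x₁ - x₂‖ := by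
    have := norm_nonneg (G x₁ - G x₂)
    have := norm_nonneg (x₁ - x₂)
    linarith
  have h1 := D.weight_sol_le (G x₁ - G x₂) (x₁ - x₂) ht.1
  have h2 := D.weight_deriv_le (G x₁ - G x₂) (x₁ - x₂) ht.1
  have h3 : unw μ (G x₁ - G x₂) t - B (D.sol (G x₁ - G x₂) (x₁ - x₂) t) =
      N (D.sol (G x₁) x₁ t) - N (D.sol (G x₂) x₂ t) := by
    rw [hunw x₁ h₁ t ht, hunw x₂ h₂ t ht, unw_sub, D.sol_sub, map_sub]
    abel
  rw [h3] at h2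
  rw [D.sol_sub] at h1
  rw [← hMdef] at h1 h2
  have h4 : M * (‖G x₁ - G x₂‖ + ‖x₁ - x₂‖) ≤ M * (2 * ‖x₁ - x₂‖) :=
    mul_le_mul_of_nonneg_left (by linarith) (by linarith)
  change t ^ (1 - μ) * (‖N (D.sol (G x₁) x₁ t) - N (D.sol (G x₂) x₂ t)‖ +
    ‖D.sol (G x₁) x₁ t - D.sol (G x₂) x₂ t‖) ≤ _
  rw [mul_add]
  linarith

end Solutions

/-! ### Continuation and maximal solutions -/

section Maximal

set_option linter.unusedSectionVars false

variable {E₀ E₁ : Type*} [NormedAddCommGroup E₀] [NormedSpace ℝ E₀] [CompleteSpace E₀]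
  [NormedAddCommGroup E₁] [NormedSpace ℝ E₁] [CompleteSpace E₁] {ι : E₁ →L[ℝ] E₀} {μ : ℝ}
  {hμ : μ ∈ Ioo (0 : ℝ) 1} {V : Set (Interp ι μ)} {N : E₁ → E₀} {X Y : Interp ι μ} {T τ : ℝ}
  {u v : ℝ → E₁}

theorem Sol.exists_extend (hinj : Function.Injective ι) (hN : Admissible ι hμ V N)
    (hu : Sol ι hμ V N X T u) {a : ℝ} (ha : 0 < a) (haT : a < T)
    (hv : Sol ι hμ V N (Interp.of ι hμ (u a)) τ v) : ∃ w, Sol ι hμ V N X (a + τ) w := by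
  rcases le_total (a + τ) T with h | h
  · exact ⟨u, hu.mono h⟩
  · exact ⟨_, hu.glue ha haT hv ((hv.mono (by linarith)).eqOn hinj hN
      (hu.mem a ⟨ha, haT.le⟩) (hu.shift ha haT))⟩

/-- Solutions that come close to `Y ∈ V` can be extended by a uniform amount of time. -/
theorem Admissible.exists_uniform_extend (hinj : Function.Injective ι) (hV : IsOpen V)
    (hN : Admissible ι hμ V N) (hY : Y ∈ V) : ∃ τ > 0, ∃ ε > 0, ∀ (X : Interp ι μ) (T : ℝ)
      (u : ℝ → E₁), Sol ι hμ V N X T u → ∀ a, 0 < a → a < T →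
        ‖Interp.of ι hμ (u a) - Y‖ ≤ ε → ∃ w, Sol ι hμ V N X (a + τ) w := by
  obtain ⟨τ, hτ, ε, hε, -, -, w, hw, -⟩ := hN.exists_sol hinj hV hY
  exact ⟨τ, hτ, ε, hε, fun X T u hu a ha haT h =>
    hu.exists_extend hinj hN ha haT (hw _ h).2⟩

/-- The solution is restarted not at `T` but shortly before, so that the pieces overlap. The
existence time `τ` is uniform near `u T`, so some `a < T` satisfies `a + τ > T`. -/
theorem Sol.exists_gt (hinj : Function.Injective ι) (hV : IsOpen V) (hN : Admissible ι hμ V N)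
    (hT : 0 < T) (hu : Sol ι hμ V N X T u) : ∃ T' > T, ∃ w, Sol ι hμ V N X T' w := by
  have hTm : T ∈ Ioc 0 T := ⟨hT, le_rfl⟩
  obtain ⟨τ, hτ, ε, hε, hext⟩ := hN.exists_uniform_extend hinj hV (hu.mem T hTm)
  have h1 : Tendsto (fun t => Interp.of ι hμ (u t)) (𝓝[Ioc 0 T] T)
      (𝓝 (Interp.of ι hμ (u T))) :=
    ((Interp.ofL ι hμ).continuous.tendsto _).comp (hu.intEq.memBC.1 T hTm)
  have h2 : 𝓝[<] T ≤ 𝓝[Ioc 0 T] T := by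
    rw [← nhdsWithin_Ioo_eq_nhdsLT hT]
    exact nhdsWithin_mono _ Ioo_subset_Ioc_self
  have h3 := ((tendsto_iff_norm_sub_tendsto_zero.1 (h1.mono_left h2)).eventually_le_const hε).and
    (Ioo_mem_nhdsLT (show max 0 (T - τ) < T from max_lt hT (by linarith)))
  obtain ⟨a, ha, ha'⟩ := h3.exists
  obtain ⟨w, hw⟩ := hext X T u hu a ((le_max_left _ _).trans_lt ha'.1) ha'.2 ha
  exact ⟨a + τ, by linarith [(le_max_right 0 (T - τ)).trans_lt ha'.1], w, hw⟩

variable (ι) in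
/-- `u` is the maximal solution with initial value `X`, and `[0, tp)` is its interval of
existence. -/
def IsMaxSol (hμ : μ ∈ Ioo (0 : ℝ) 1) (V : Set (Interp ι μ)) (N : E₁ → E₀) (X : Interp ι μ)
    (tp : EReal) (u : ℝ → E₁) : Prop :=
  0 < tp ∧ (∀ T : ℝ, 0 < T → (T : EReal) < tp → Sol ι hμ V N X T u) ∧
    ∀ (T : ℝ) (v : ℝ → E₁), 0 < T → Sol ι hμ V N X T v → (T : EReal) < tp ∧ EqOn v u (Ioc 0 T)

theorem Admissible.exists_isMaxSol (hinj : Function.Injective ι) (hV : IsOpen V)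
    (hN : Admissible ι hμ V N) (hX : X ∈ V) : ∃ tp u, IsMaxSol ι hμ V N X tp u := by
  classical
  let P : ℝ → Prop := fun T => 0 < T ∧ ∃ v, Sol ι hμ V N X T v
  -- By uniqueness the choice of a solution on `[0,t]` does not affect its value at `t`. The value
  -- `0` is used only where no solution reaches.
  let u : ℝ → E₁ := fun t => if h : ∃ v, Sol ι hμ V N X t v then h.choose t else 0
  have hu : ∀ T v, Sol ι hμ V N X T v → EqOn v u (Ioc 0 T) := fun T v hv t ht => by
    have h : ∃ v, Sol ι hμ V N X t v := ⟨v, hv.mono ht.2⟩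
    simp only [u, dif_pos h]
    exact (hv.mono ht.2).eqOn hinj hN hX h.choose_spec ⟨ht.1, le_rfl⟩
  refine ⟨sSup ((fun T : ℝ => (T : EReal)) '' {T | P T}), u, ?_, fun T hT hTt => ?_,
    fun T v hT hv => ⟨?_, hu T v hv⟩⟩
  · obtain ⟨τ, hτ, ε, hε, -, -, w, hw, -⟩ := hN.exists_sol hinj hV hX
    have h1 := hw X (by simpa using hε.le)
    exact lt_sSup_iff.2 ⟨_, ⟨τ, ⟨hτ, _, h1.2⟩, rfl⟩, EReal.coe_pos.2 hτ⟩
  · obtain ⟨_, ⟨T', ⟨hT', v, hv⟩, rfl⟩, hlt⟩ := lt_sSup_iff.1 hTt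
    have h1 := hv.mono (EReal.coe_lt_coe_iff.1 hlt).le
    exact h1.congr hT (hu T v h1).symm
  · obtain ⟨T', hT', w, hw⟩ := hv.exists_gt hinj hV hN hT
    exact lt_sSup_iff.2 ⟨_, ⟨T', ⟨hT.trans hT', w, hw⟩, rfl⟩, EReal.coe_lt_coe_iff.2 hT'⟩

namespace IsMaxSol

variable {tp : EReal}

theorem continuousAt (h : IsMaxSol ι hμ V N X tp u) {t : ℝ} (ht : 0 < t) (htp : (t : EReal) < tp) : ContinuousAt u t := by
  obtain ⟨T, h1, h2⟩ := EReal.lt_iff_exists_real_btwn.1 htp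
  have h1' : t < T := EReal.coe_lt_coe_iff.1 h1
  exact ((h.2.1 T (ht.trans h1') h2).intEq.memBC.1 t ⟨ht, h1'.le⟩).continuousAt
    (Ioc_mem_nhds ht h1')

theorem continuousOn_orbit (h : IsMaxSol ι hμ V N X tp u) :
    ContinuousOn (orbit ι hμ X u) {t : ℝ | 0 ≤ t ∧ (t : EReal) < tp} := by
  intro t ht
  rcases eq_or_lt_of_le ht.1 with rfl | h0
  · obtain ⟨T, h1, h2⟩ := EReal.lt_iff_exists_real_btwn.1 h.1
    have hT : 0 < T := EReal.coe_pos.1 h1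
    have h3 := (h.2.1 T hT h2).intEq.tendsto_of hμ hT
    have h4 : ContinuousWithinAt (orbit ι hμ X u) (Ioi 0) 0 := by
      unfold ContinuousWithinAt
      rw [orbit, if_neg (lt_irrefl 0)]
      refine h3.congr' ?_
      filter_upwards [self_mem_nhdsWithin] with s hs
      exact (if_pos hs).symm
    refine (continuousWithinAt_insert_self.2 h4).mono fun s hs => ?_
    rcases eq_or_lt_of_le hs.1 with h | h
    · exact Or.inl h.symm
    · exact Or.inr h
  · have h1 : ContinuousAt (fun s => Interp.of ι hμ (u s)) t :=
      ((Interp.ofL ι hμ).continuous.continuousAt).comp (h.continuousAt h0 ht.2)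
    refine (h1.congr ?_).continuousWithinAt
    filter_upwards [Ioi_mem_nhds h0] with s hs
    exact (if_pos hs).symm

theorem mem (h : IsMaxSol ι hμ V N X tp u) {t : ℝ} (ht : 0 < t) (htp : (t : EReal) < tp) : Interp.of ι hμ (u t) ∈ V :=
  (h.2.1 t ht htp).mem t ⟨ht, le_rfl⟩

end IsMaxSol

/-- Near `Y` solutions continue for a uniform time `τ`. A visit to this neighbourhood later than `b
- τ` would extend the solution beyond `b`. -/
theorem IsMaxSol.not_frequently_near {b : ℝ} (h : IsMaxSol ι hμ V N X (b : EReal) u)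
    (hinj : Function.Injective ι) (hV : IsOpen V) (hN : Admissible ι hμ V N) (hY : Y ∈ V) :
    ¬ ∀ ε > 0, ∃ᶠ t in 𝓝[<] b, ‖Interp.of ι hμ (u t) - Y‖ ≤ ε := by
  intro hfreq
  have hb : 0 < b := EReal.coe_pos.1 h.1
  obtain ⟨τ, hτ, ε, hε, hext⟩ := hN.exists_uniform_extend hinj hV hY
  obtain ⟨t, ht, ht'⟩ := ((hfreq ε hε).and_eventually
    (Ioo_mem_nhdsLT (show max 0 (b - τ) < b from max_lt hb (by linarith)))).exists
  have ht0 : 0 < t := (le_max_left _ _).trans_lt ht'.1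
  have htτ : b - τ < t := (le_max_right _ _).trans_lt ht'.1
  have htb : t < b := ht'.2
  obtain ⟨w, hw⟩ := hext X ((t + b) / 2) u
    (h.2.1 _ (by linarith) (EReal.coe_lt_coe_iff.2 (by linarith))) t ht0 (by linarith) ht
  have := EReal.coe_lt_coe_iff.1 (h.2.2 (t + τ) w (by linarith) hw).1
  linarith

/-- A solution that stays away from the boundary of `V` and has an accumulation point in `E_μ` at
the end of its interval of existence is global. -/
theorem IsMaxSol.eq_top {tp : EReal} (h : IsMaxSol ι hμ V N X tp u)
    (hinj : Function.Injective ι) (hV : IsOpen V) (hN : Admissible ι hμ V N)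
    (haway : AwayFromBoundary ι hμ V X tp u)
    (hacc : ∀ b : ℝ, tp = b → ∃ Y : Interp ι μ,
      ∀ ε > 0, ∃ᶠ t in 𝓝[<] b, ‖Interp.of ι hμ (u t) - Y‖ ≤ ε) : tp = ⊤ := by
  induction tp with
  | bot => exact absurd h.1 not_lt_bot
  | top => rfl
  | coe b =>
    exfalso
    have hb : 0 < b := EReal.coe_pos.1 h.1
    obtain ⟨Y, hY⟩ := hacc b rfl
    obtain ⟨η, hη, haway⟩ := haway
    have hcl : Y ∈ closure V := by
      rw [Metric.mem_closure_iff]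
      intro ε hε
      obtain ⟨t, ht, ht'⟩ := ((hY (ε / 2) (by linarith)).and_eventually
        (Ioo_mem_nhdsLT hb)).exists
      refine ⟨_, h.mem ht'.1 (EReal.coe_lt_coe_iff.2 ht'.2), ?_⟩
      rw [dist_comm, dist_eq_norm]
      linarith
    have hYV : Y ∈ V := by
      -- Otherwise `Y` is a boundary point of the open set `V`, and the orbit comes within `η` of
      -- it.
      by_contra hnot
      have hfr : Y ∈ frontier V := by
        rw [hV.frontier_eq]
        exact ⟨hcl, hnot⟩
      obtain ⟨t, ht, ht'⟩ := ((hY η hη).and_eventually (Ioo_mem_nhdsLT hb)).exists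
      have h1 := haway t ht'.1.le (EReal.coe_lt_coe_iff.2 ht'.2)
      rw [orbit, if_pos ht'.1] at h1
      have h2 := h1.trans_le (Metric.infEDist_le_edist_of_mem hfr)
      rw [edist_dist, dist_eq_norm] at h2
      exact absurd (ENNReal.ofReal_le_ofReal ht) (not_le.2 h2)
    exact h.not_frequently_near hinj hV hN hYV hY

end Maximal

/-! ### Compactness in the interpolation scale -/

section Compactness

set_option linter.unusedSectionVars false

variable {E₀ E₁ : Type*} [NormedAddCommGroup E₀] [NormedSpace ℝ E₀] [CompleteSpace E₀]
  [NormedAddCommGroup E₁] [NormedSpace ℝ E₁] {ι : E₁ →L[ℝ] E₀} {μ δ C : ℝ}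

/-- For a fixed small `t`, a decomposition that nearly realizes `kFun ι t` puts every element within
`ε / 2` of the image of one ball of `E₁`, which is relatively compact in `E₀`. -/
theorem totallyBounded_range_of_kFun_le (hι : IsCompactOperator ι) (hδ : 0 < δ)
    {y : ℕ → E₁} (hy : ∀ n, ∀ t > 0, kFun ι t (ι (y n)) ≤ t ^ δ * C) :
    TotallyBounded (range fun n => ι (y n)) := by
  rw [Metric.totallyBounded_iff]
  intro ε hε
  have hlim := (tendsto_rpow_zero hδ).mul_const C
  rw [zero_mul] at hlim
  obtain ⟨t, ht, ht0⟩ := ((hlim.eventually_lt_const (show 0 < ε / 2 by linarith)).and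
    self_mem_nhdsWithin).exists
  have ht0 : 0 < t := ht0
  have hK : IsCompact (closure (ι '' Metric.closedBall 0 (ε / 2 / t))) :=
    hι.isCompact_closure_image_closedBall _
  obtain ⟨s, hs, hcov⟩ := Metric.totallyBounded_iff.1
    (hK.totallyBounded.subset subset_closure) (ε / 2) (by linarith)
  refine ⟨s, hs, ?_⟩
  rintro _ ⟨n, rfl⟩
  obtain ⟨b, hb⟩ := exists_lt_of_ciInf_lt ((hy n t ht0).trans_lt ht)
  have hb1 : ‖b‖ ≤ ε / 2 / t := by
    rw [le_div_iff₀ ht0]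
    linarith [norm_nonneg (ι (y n) - ι b)]
  have hb2 : ‖ι (y n) - ι b‖ < ε / 2 := by
    have := mul_nonneg ht0.le (norm_nonneg b)
    linarith
  obtain ⟨z, hz, hzb⟩ := mem_iUnion₂.1 (hcov ⟨b, mem_closedBall_zero_iff.2 hb1, rfl⟩)
  refine mem_iUnion₂.2 ⟨z, hz, ?_⟩
  rw [← dist_eq_norm] at hb2
  exact (dist_triangle _ _ _).trans_lt (by linarith [Metric.mem_ball.1 hzb])

/-- If `E₁` is compactly embedded in `E₀` then sequences that are bounded in `E_δ`, `δ > μ`, have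
convergent subsequences in `E_μ`. -/
theorem exists_subseq_tendsto_of_kFun_le (hι : IsCompactOperator ι) (hμ : μ ∈ Ioo (0 : ℝ) 1)
    (hδ : μ < δ) {y : ℕ → E₁} (hy : ∀ n, ∀ t > 0, kFun ι t (ι (y n)) ≤ t ^ δ * C) :
    ∃ (Y : Interp ι μ) (φ : ℕ → ℕ), StrictMono φ ∧
      Tendsto (fun n => Interp.of ι hμ (y (φ n))) atTop (𝓝 Y) := by
  have hδ0 : 0 < δ := hμ.1.trans hδ
  have hcomp : IsCompact (closure (range fun n => ι (y n))) :=
    (totallyBounded_range_of_kFun_le hι hδ0 hy).closure.isCompact_of_isClosed isClosed_closure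
  obtain ⟨z, -, φ, hφ, hlim⟩ := hcomp.tendsto_subseq fun n => subset_closure (mem_range_self n)
  have hC : 0 ≤ C := by
    have := (kFun_nonneg ι one_pos (ι (y 0))).trans (hy 0 1 one_pos)
    simpa using this
  -- The exponent that places `E_μ` between `E₀` and `E_δ`. As `θ < 1`, convergence in `E₀` together
  -- with the bound in `E_δ` gives a Cauchy sequence in `E_μ`.
  set θ := μ / δ with hθ
  have hθ1 : θ < 1 := (div_lt_one hδ0).2 hδ
  have hθ0 : 0 ≤ θ := div_nonneg hμ.1.le hδ0.le
  have key : ∀ m n, ‖Interp.of ι hμ (y m) - Interp.of ι hμ (y n)‖ ≤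
      ‖ι (y m) - ι (y n)‖ ^ (1 - θ) * (2 * C) ^ θ := fun m n => by
    refine Interp.norm_le_of_kFun_le fun t ht => ?_
    have h1 : kFun ι t (ι (y m) - ι (y n)) ≤ t ^ δ * (2 * C) := by
      have h2 := kFun_add ι ht (ι (y m)) (-ι (y n))
      have h3 := kFun_smul ι ht (-1) (ι (y n))
      rw [norm_neg, norm_one, one_mul, neg_one_smul] at h3
      rw [← sub_eq_add_neg] at h2
      linarith [hy m t ht, hy n t ht]
    rw [Interp.val_sub, Interp.val_of, Interp.val_of]
    refine (rpow_one_sub_mul_rpow_le (kFun_nonneg ι ht _) (kFun_le_norm ι ht _) h1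
      ⟨hθ0, hθ1.le⟩).trans (le_of_eq ?_)
    rw [Real.mul_rpow (by positivity) (by positivity), ← Real.rpow_mul ht.le,
      show δ * θ = μ from mul_div_cancel₀ _ hδ0.ne']
    ring
  have hcau : CauchySeq fun n => Interp.of ι hμ (y (φ n)) := by
    have h1 : CauchySeq fun n => ι (y (φ n)) := hlim.cauchySeq
    rw [cauchySeq_iff_tendsto_dist_atTop_0] at h1 ⊢
    have h2 := (Real.continuousAt_rpow_const 0 (1 - θ) (Or.inr (by linarith))).tendsto.comp h1
    rw [Real.zero_rpow (by linarith)] at h2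
    have h3 := h2.mul_const ((2 * C) ^ θ)
    rw [zero_mul] at h3
    refine squeeze_zero (fun _ => dist_nonneg) (fun p => ?_) h3
    rw [dist_eq_norm]
    simpa only [Function.comp_apply, dist_eq_norm] using key (φ p.1) (φ p.2)
  obtain ⟨Y, hY⟩ := cauchySeq_tendsto_of_complete hcau
  exact ⟨Y, φ, hφ, hY⟩

theorem kFun_le_of_scaleNorm_le (hδ : δ ∈ Ioc (0 : ℝ) 1) {y : E₁} (hy : scaleNorm ι δ y ≤ C)
    {t : ℝ} (ht : 0 < t) : kFun ι t (ι y) ≤ t ^ δ * C := by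
  unfold scaleNorm at hy
  split_ifs at hy with h
  · rw [h, Real.rpow_one]
    exact (kFun_map_le ι ht y).trans (mul_le_mul_of_nonneg_left hy ht.le)
  · exact ((Interp.of ι ⟨hδ.1, lt_of_le_of_ne hδ.2 h⟩ y).kFun_le ht).trans
      (mul_le_mul_of_nonneg_left hy (Real.rpow_nonneg ht.le _))

end Compactness

/-! ### From the integrated equation back to the stated one -/

section Equation

set_option linter.unusedSectionVars false

variable {E₀ E₁ : Type*} [NormedAddCommGroup E₀] [NormedSpace ℝ E₀] [CompleteSpace E₀]
  [NormedAddCommGroup E₁] [NormedSpace ℝ E₁] {ι : E₁ →L[ℝ] E₀} {μ : ℝ}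
  {hμ : μ ∈ Ioo (0 : ℝ) 1} {V : Set (Interp ι μ)} {A : Interp ι μ → E₁ →L[ℝ] E₀}
  {F₁ F₂ : Interp ι μ → E₀} {X : Interp ι μ}

theorem isSolution_iff {T : ℝ} (hT : 0 < T) {u : ℝ → E₁} :
    IsSolution ι hμ V A F₁ F₂ X T u ↔ X ∈ V ∧ Sol ι hμ V (rhs ι hμ A F₁ F₂) X T u := by
  constructor
  · rintro ⟨h1, h2, h3, h4⟩
    exact ⟨h2, IntEq.of_memE1 hμ hT h1 h3 fun t ht => eq_sub_of_add_eq (h4 t ht).2,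
      fun t ht => (h4 t ht).1⟩
  · rintro ⟨h1, h2⟩
    exact ⟨h2.intEq.memE1 hμ hT, h1, h2.intEq.hasTrace hμ hT, fun t ht => ⟨h2.mem t ht, by
      rw [h2.intEq.dt_eq hμ ht]; exact sub_add_cancel _ _⟩⟩

theorem isMaximalSolution_iff (hX : X ∈ V) {tp : EReal} {u : ℝ → E₁} :
    IsMaximalSolution ι hμ V A F₁ F₂ X tp u ↔
      IsMaxSol ι hμ V (rhs ι hμ A F₁ F₂) X tp u := by
  unfold IsMaximalSolution IsMaxSol
  refine and_congr_right fun _ => and_congr ?_ ?_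
  · refine forall_congr' fun T => forall_congr' fun hT => forall_congr' fun _ => ?_
    rw [isSolution_iff hT, and_iff_right hX]
  · refine forall_congr' fun T => forall_congr' fun v => forall_congr' fun hT => ?_
    rw [isSolution_iff hT, and_iff_right hX]

theorem normE1_sub_le {N : E₁ → E₀} {τ C : ℝ} (hτ : 0 < τ) {X₁ X₂ : Interp ι μ} {u₁ u₂ : ℝ → E₁}
    (h₁ : Sol ι hμ V N X₁ τ u₁) (h₂ : Sol ι hμ V N X₂ τ u₂)
    (h : ∀ t ∈ Ioc 0 τ, t ^ (1 - μ) * (‖N (u₁ t) - N (u₂ t)‖ + ‖u₁ t - u₂ t‖) ≤ C) :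
    normE1 ι μ τ (u₁ - u₂) ≤ C := by
  have : Nonempty (Ioc 0 τ) := ⟨⟨τ, hτ, le_rfl⟩⟩
  refine ciSup_le fun t => ?_
  have h1 : dt ι τ (u₁ - u₂) t = N (u₁ t) - N (u₂ t) := (h₁.intEq.sub hμ h₂.intEq).dt_eq hμ t.2
  rw [h1]
  exact h t t.2

end Equation

end QuasiPar

end

/-! ### The theorem -/

theorem theorem2p2 {E₀ E₁ : Type*}
    [NormedAddCommGroup E₀] [NormedSpace ℝ E₀] [CompleteSpace E₀]
    [NormedAddCommGroup E₁] [NormedSpace ℝ E₁] [CompleteSpace E₁]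
    (ι : E₁ →L[ℝ] E₀) (hinj : Function.Injective ι) (hdense : DenseRange ι)
    (μ : ℝ) (hμ : μ ∈ Set.Ioo (0 : ℝ) 1)
    (V : Set (QuasiPar.Interp ι μ)) (hV : IsOpen V)
    (A : QuasiPar.Interp ι μ → E₁ →L[ℝ] E₀) (F₁ F₂ : QuasiPar.Interp ι μ → E₀)
    (h1 : QuasiPar.H1 ι V A F₁) (h2 : QuasiPar.H2 ι V F₂) :
    -- (a) local solutions
    (∀ x₀ ∈ V, ∃ τ > 0, ∃ ε > 0, ∃ σ > 0, ∃ u : QuasiPar.Interp ι μ → ℝ → E₁,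
      (∀ x ∈ Metric.closedBall x₀ ε,
        QuasiPar.IsSolution ι hμ V A F₁ F₂ x τ (u x) ∧
        ∀ v : ℝ → E₁, QuasiPar.IsSolution ι hμ V A F₁ F₂ x τ v →
          Set.EqOn v (u x) (Set.Ioc 0 τ)) ∧
      ∀ x₁ ∈ Metric.closedBall x₀ ε, ∀ x₂ ∈ Metric.closedBall x₀ ε,
        QuasiPar.normE1 ι μ τ (u x₁ - u x₂) ≤ σ * ‖x₁ - x₂‖) ∧
    -- (b) maximal solutions
    (∀ x₀ ∈ V, ∃ (tp : EReal) (u : ℝ → E₁),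
      QuasiPar.IsMaximalSolution ι hμ V A F₁ F₂ x₀ tp u ∧
      ContinuousOn (QuasiPar.orbit ι hμ x₀ u) {t : ℝ | 0 ≤ t ∧ (t : EReal) < tp} ∧
      ContinuousOn u {t : ℝ | 0 < t ∧ (t : EReal) < tp}) ∧
    -- (c) global solutions
    (∀ x₀ ∈ V, ∀ (tp : EReal) (u : ℝ → E₁),
      QuasiPar.IsMaximalSolution ι hμ V A F₁ F₂ x₀ tp u →
      QuasiPar.AwayFromBoundary ι hμ V x₀ tp u →
      (UniformContinuousOn (QuasiPar.orbit ι hμ x₀ u) {t : ℝ | 0 ≤ t ∧ (t : EReal) < tp} →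
        tp = ⊤) ∧
      (IsCompactOperator ι →
        (∃ δ ∈ Set.Ioc μ 1, ∃ τ : ℝ, 0 < τ ∧ (τ : EReal) < tp ∧
          ∃ C : ℝ, ∀ t : ℝ, τ ≤ t → (t : EReal) < tp → QuasiPar.scaleNorm ι δ (u t) ≤ C) →
        tp = ⊤)) := by
  have hN : QuasiPar.Admissible ι hμ V (QuasiPar.rhs ι hμ A F₁ F₂) :=
    QuasiPar.admissible_rhs hμ hV h1 h2
  refine ⟨fun X hX => ?_, fun X hX => ?_, fun X hX tp u hmax haway => ⟨fun hunif => ?_, ?_⟩⟩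
  · obtain ⟨τ, hτ, ε, hε, σ, hσ, u, hu, hlip⟩ := hN.exists_sol hinj hV hX
    refine ⟨τ, hτ, ε, hε, σ, hσ, u, fun x hx => ?_, fun x₁ hx₁ x₂ hx₂ => ?_⟩
    · obtain ⟨hxV, hsol⟩ := hu x (mem_closedBall_iff_norm.1 hx)
      exact ⟨(QuasiPar.isSolution_iff hτ).2 ⟨hxV, hsol⟩, fun v hv =>
        ((QuasiPar.isSolution_iff hτ).1 hv).2.eqOn hinj hN hxV hsol⟩
    · rw [mem_closedBall_iff_norm] at hx₁ hx₂
      exact QuasiPar.normE1_sub_le hτ (hu x₁ hx₁).2 (hu x₂ hx₂).2 (hlip x₁ hx₁ x₂ hx₂)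
  · obtain ⟨tp, u, h⟩ := hN.exists_isMaxSol hinj hV hX
    exact ⟨tp, u, (QuasiPar.isMaximalSolution_iff hX).2 h, h.continuousOn_orbit,
      fun t ht => (h.continuousAt ht.1 ht.2).continuousWithinAt⟩
  · have h := (QuasiPar.isMaximalSolution_iff hX).1 hmax
    refine h.eq_top hinj hV hN haway ?_
    rintro b rfl
    have hb : 0 < b := EReal.coe_pos.1 h.1
    have hev : ∀ᶠ t in 𝓝[<] b, t ∈ Set.Ioo 0 b := Ioo_mem_nhdsLT hb
    -- A uniformly continuous map carries the Cauchy filter of left neighbourhoods of `b` to a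
    -- Cauchy filter, which converges since `E_μ` is complete.
    obtain ⟨Y, hY⟩ := CompleteSpace.complete
      ((cauchy_nhds.mono nhdsWithin_le_nhds : Cauchy (𝓝[<] b)).map_of_le hunif
        (le_principal_iff.2 (hev.mono fun t ht => ⟨ht.1.le, EReal.coe_lt_coe_iff.2 ht.2⟩)))
    refine ⟨Y, fun ε hε => Eventually.frequently ?_⟩
    have hlim : Tendsto (QuasiPar.orbit ι hμ X u) (𝓝[<] b) (𝓝 Y) := hY
    filter_upwards [(tendsto_iff_norm_sub_tendsto_zero.1 hlim).eventually_le_const hε, hev]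
      with t ht ht'
    rwa [QuasiPar.orbit, if_pos ht'.1] at ht
  · rintro hι ⟨δ, hδ, τ, -, hτ, C, hC⟩
    have h := (QuasiPar.isMaximalSolution_iff hX).1 hmax
    refine h.eq_top hinj hV hN haway ?_
    rintro b rfl
    -- Times in `(τ, b)` that increase to `b`; a subsequence of the orbit along them converges in
    -- `E_μ`, and an accumulation point is all that is needed.
    obtain ⟨s, -, hs, hslim⟩ := exists_seq_strictMono_tendsto' (EReal.coe_lt_coe_iff.1 hτ)
    obtain ⟨Y, φ, hφ, hY⟩ := QuasiPar.exists_subseq_tendsto_of_kFun_le hι hμ hδ.1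
      (y := fun n => u (s n)) fun n t ht => QuasiPar.kFun_le_of_scaleNorm_le
        ⟨hμ.1.trans hδ.1, hδ.2⟩ (hC (s n) (hs n).1.le (EReal.coe_lt_coe_iff.2 (hs n).2)) ht
    have hsφ : Tendsto (fun n => s (φ n)) atTop (𝓝[<] b) :=
      tendsto_nhdsWithin_iff.2 ⟨hslim.comp hφ.tendsto_atTop,
        Eventually.of_forall fun n => (hs (φ n)).2⟩
    exact ⟨Y, fun ε hε => hsφ.frequently
      ((tendsto_iff_norm_sub_tendsto_zero.1 hY).eventually_le_const hε).frequently⟩
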